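/- **Definitions.** A *composition structure* is a Markovian sequence $(\mathcal C_n)_{n\ge 1}$, where $\mathcal C_n$ is a random composition of $n$, such that, given $\mathcal C_{n+1},\mathcal C_{n+2},\dots$, the composition $\mathcal C_n$ is obtained by regarding $\mathcal C_{n+1}$ as a distribution of $n+1$ identical balls into an ordered row of non-empty boxes, discarding a uniformly chosen ball, and deleting the empty box if one is created. It is *regenerative* if for all $n>m\ge 1$, given that the first part of $\mathcal C_n$ is $m$, the remaining composition of $n-m$ is distributed like $\mathcal C_{n-m}$. A random partition $\Pi$ of $\mathbb N$ is *exchangeable* if its law is invariant under all finite permutations of $\mathbb N$. It *corresponds* to $(\mathcal C_n)$ if for each $n$ its restriction to $\{1,\dots,n\}$ is distributed like the partition of $\{1,\dots,n\}$ obtained by labelling the $n$ balls of $\mathcal C_n$ with an independent uniform random permutation and ignoring the order of the boxes. A *partition structure* is a sequence of laws on the partitions of the integers $n$, $n \ge 1$, consistent under discarding a uniformly chosen ball; it is *induced* by $(\mathcal C_n)$ if for each $n$ the $n$-th law is that of the decreasing rearrangement of the parts of $\mathcal C_n$. Closed subsets of $[0,1]$ are understood to contain $0$ and $1$. For such a set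 $R$ and $z\in[0,1)$ let $D(R,z)=\inf (R\cap(z,1])$ and, if $D(R,z)<1$, $$R(z)=\Big\{\frac{y-D(R,z)}{1-D(R,z)} : y\in R\cap[D(R,z),1]\Big\}.$$ A random closed set $\widetilde{\mathcal R}\subset[0,1]$ is *multiplicatively regenerative* if for each $z\in[0,1)$ with $\mathbb P(D(\widetilde{\mathcal R},z)<1)>0$, conditionally on $\{D(\widetilde{\mathcal R},z)<1\}$, the random set $\widetilde{\mathcal R}(z)$ is independent of $[0,D(\widetilde{\mathcal R},z)]\cap\widetilde{\mathcal R}$ and has the same distribution as $\widetilde{\mathcal R}$. The *ranked lengths* of $[0,1]\setminus\widetilde{\mathcal R}$ are the lengths of its interval components in decreasing order, counted with multiplicity and followed by zeros if there are finitely many. **Corollary.** (i) For each distribution of an exchangeable partition of $\mathbb N$ there is at most one distribution of a regenerative composition structure $(\mathcal C_n)_{n\ge1}$ to which it corresponds. (ii) Likewise, each partition structure is induced by at most one distribution of a regenerative composition structure. (iii) For each distribution of a decreasing random sequence $(Y_j)_{j\ge1}$ with $Y_j\ge 0$ and $\sum_j Y_j\le 1$ there is at most one distribution of a multiplicatively regenerative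 set $\widetilde{\mathcal R}\subset[0,1]$ such that the ranked lengths of the interval components of $[0,1]\setminus\widetilde{\mathcal R}$ are distributed like $(Y_j)_{j\ge1}$. -/

import Mathlib

open MeasureTheory ProbabilityTheory TopologicalSpace
open scoped ENNReal Nat

/-! ### Composition structures -/

/-- Compositions of `n` form a finite set; it carries the discrete σ-algebra. -/
instance Composition.instDiscreteMeasurableSpace (n : ℕ) : MeasurableSpace (Composition n) := ⊤

/-- The sequence of box contents that is left when ball `i` is discarded from the row of balls
distributed into boxes according to `c`, an empty box being deleted. -/
def Composition.discardBall {n : ℕ} (c : Composition n) (i : Fin n) : List ℕ :=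
  (c.blocks.modify (c.index i) (fun m => m - 1)).filter (fun m => 0 < m)

/-- The probability that discarding a uniformly chosen ball from the composition `c` of `n + 1`
leaves the composition `d` of `n`. -/
noncomputable def cotransition {n : ℕ} (c : Composition (n + 1)) (d : Composition n) : ℝ≥0∞ :=
  ({i : Fin (n + 1) | c.discardBall i = d.blocks}.ncard : ℝ≥0∞) / ((n + 1 : ℕ) : ℝ≥0∞)

/-- `(C n)` is a composition structure: a Markovian sequence of random compositions of `n` such
that, given `C (n + 1), C (n + 2), …`, the composition `C n` is obtained from `C (n + 1)` by
discarding a ball chosen uniformly at random.  (The term with `n = 0` is the empty composition and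
carries no information.) -/
structure IsCompositionStructure {Ω : Type*} [MeasurableSpace Ω] (μ : Measure Ω)
    (C : (n : ℕ) → Ω → Composition n) : Prop where
  measurable : ∀ n, Measurable (C n)
  sampling : ∀ (n k : ℕ) (c : (j : ℕ) → Composition j),
    μ {ω | ∀ j ∈ Set.Icc n (n + 1 + k), C j ω = c j} =
      cotransition (c (n + 1)) (c n) * μ {ω | ∀ j ∈ Set.Icc (n + 1) (n + 1 + k), C j ω = c j}

/-- A composition structure is regenerative if for all `m, k ≥ 1`, given that the first part of
`C (m + k)` is `m`, the remaining composition of `k` is distributed like `C k`. -/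
structure IsRegenerativeCompositionStructure {Ω : Type*} [MeasurableSpace Ω] (μ : Measure Ω)
    (C : (n : ℕ) → Ω → Composition n) : Prop extends IsCompositionStructure μ C where
  regenerative : ∀ m k : ℕ, 1 ≤ m → 1 ≤ k →
    μ {ω | (C (m + k) ω).blocks.head? = some m} ≠ 0 → ∀ c : Composition k,
      μ[{ω | (C (m + k) ω).blocks.tail = c.blocks} | {ω | (C (m + k) ω).blocks.head? = some m}] =
        μ {ω | C k ω = c}

/-! ### Exchangeable partitions and partition structures -/

/-- Partitions of `ℕ` are equivalence relations on `ℕ`; the σ-algebra is generated by the events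
that `i` and `j` are in the same class. -/
instance Setoid.instMeasurableSpaceNat : MeasurableSpace (Setoid ℕ) :=
  MeasurableSpace.generateFrom {S | ∃ i j : ℕ, S = {r : Setoid ℕ | r i j}}

/-- A random partition of `ℕ` whose law is invariant under all finite permutations of `ℕ`. -/
structure IsExchangeablePartition {Ω : Type*} [MeasurableSpace Ω] (μ : Measure Ω)
    (P : Ω → Setoid ℕ) : Prop where
  measurable : Measurable P
  exchangeable : ∀ σ : Equiv.Perm ℕ, {i | σ i ≠ i}.Finite →
    IdentDistrib (fun ω => (P ω).comap σ) P μ μ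

/-- The law of the random partition `P` of `ℕ` corresponds to the composition structure `C`: for
each `n`, the restriction of `P` to the first `n` elements has the law of the partition of these
`n` elements which is obtained from `C n` by labelling the balls with an independent uniform
random permutation and ignoring the order of the boxes. -/
def PartitionCorrespondsTo {Ω₀ Ω : Type*} [MeasurableSpace Ω₀] [MeasurableSpace Ω]
    (μ₀ : Measure Ω₀) (P : Ω₀ → Setoid ℕ) (μ : Measure Ω)
    (C : (n : ℕ) → Ω → Composition n) : Prop :=
  ∀ (n : ℕ) (π : Setoid (Fin n)),
    μ₀ {ω | (P ω).comap (fun i : Fin n => (i : ℕ)) = π} =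
      ∑ c : Composition n, μ {ω | C n ω = c} *
        (({σ : Equiv.Perm (Fin n) | Setoid.ker (fun i => c.index (σ i)) = π}.ncard : ℝ≥0∞) /
          (n ! : ℝ≥0∞))

/-- A partition structure: laws `p n` on the partitions of the integers `n`, such that a partition
of `n + 1` with law `p (n + 1)`, regarded as a distribution of `n + 1` balls into boxes, becomes a
partition with law `p n` when a uniformly chosen ball is discarded (it lies in a box of size `m`
with probability `m / (n + 1)`, and an empty box is deleted). -/
def IsPartitionStructure (p : (n : ℕ) → PMF n.Partition) : Prop :=
  ∀ (n : ℕ) (l : n.Partition),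
    p n l = ∑ r : (n + 1).Partition, p (n + 1) r *
      (((r.parts.map (fun m =>
          if (r.parts.erase m + {m - 1}).filter (fun a => 0 < a) = l.parts then m else 0)).sum :
            ℕ) : ℝ≥0∞) / ((n + 1 : ℕ) : ℝ≥0∞)

/-- The partition structure `p` is induced by `C` by ignoring the order of the parts. -/
def InducesPartitionStructure {Ω : Type*} [MeasurableSpace Ω] (μ : Measure Ω)
    (C : (n : ℕ) → Ω → Composition n) (p : (n : ℕ) → PMF n.Partition) : Prop :=
  ∀ (n : ℕ) (l : n.Partition), μ {ω | Nat.Partition.ofComposition n (C n ω) = l} = p n l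

/-! ### Multiplicatively regenerative sets -/

/-- The σ-algebra on closed subsets of the line generated by the events that the set hits a given
open set. -/
instance closedsRealMeasurableSpace : MeasurableSpace (Closeds ℝ) :=
  MeasurableSpace.generateFrom
    {S | ∃ G : Set ℝ, IsOpen G ∧ S = {F : Closeds ℝ | ((F : Set ℝ) ∩ G).Nonempty}}

/-- A random closed subset of `[0,1]` that contains `0` and `1`. -/
structure IsRandomClosedSubset {Ω : Type*} [MeasurableSpace Ω] (R : Ω → Closeds ℝ) : Prop where
  measurable : Measurable R
  subset_unit : ∀ ω, (R ω : Set ℝ) ⊆ Set.Icc 0 1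
  zero_mem : ∀ ω, (0 : ℝ) ∈ R ω
  one_mem : ∀ ω, (1 : ℝ) ∈ R ω

/-- `D(F, z)`, the first point of `F` strictly to the right of `z`. -/
noncomputable def firstPointAfter (F : Closeds ℝ) (z : ℝ) : ℝ :=
  sInf ((F : Set ℝ) ∩ Set.Ioc z 1)

/-- `[0, D(F, z)] ∩ F`. -/
noncomputable def partBefore (F : Closeds ℝ) (z : ℝ) : Closeds ℝ where
  carrier := Set.Icc 0 (firstPointAfter F z) ∩ F
  isClosed' := isClosed_Icc.inter F.isClosed

/-- `F(z)`, the part of `F` to the right of `D(F, z)`, scaled back to `[0,1]`; meaningful when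
`D(F, z) < 1`. -/
noncomputable def rescaledPartAfter (F : Closeds ℝ) (z : ℝ) : Closeds ℝ where
  carrier := (fun y : ℝ => (y - firstPointAfter F z) / (1 - firstPointAfter F z)) ''
    ((F : Set ℝ) ∩ Set.Icc (firstPointAfter F z) 1)
  isClosed' := ((isCompact_Icc.inter_left F.isClosed).image (by fun_prop)).isClosed

/-- A multiplicatively regenerative random closed subset of `[0,1]`. -/
structure IsMultiplicativelyRegenerative {Ω : Type*} [MeasurableSpace Ω] (μ : Measure Ω)
    (R : Ω → Closeds ℝ) : Prop extends IsRandomClosedSubset R where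
  regenerative : ∀ z ∈ Set.Ico (0 : ℝ) 1, μ {ω | firstPointAfter (R ω) z < 1} ≠ 0 →
    IndepFun (fun ω => rescaledPartAfter (R ω) z) (fun ω => partBefore (R ω) z)
        (μ[|{ω | firstPointAfter (R ω) z < 1}]) ∧
      IdentDistrib (fun ω => rescaledPartAfter (R ω) z) R
        (μ[|{ω | firstPointAfter (R ω) z < 1}]) μ

/-- The interval components `]a, b[` of `[0,1] \ F`, for a closed `F ⊆ [0,1]` that contains `0` and
`1`, given by their pairs of end points `(a, b)`. -/
def gaps (F : Closeds ℝ) : Set (ℝ × ℝ) :=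
  {I | I.1 < I.2 ∧ I.1 ∈ F ∧ I.2 ∈ F ∧ Disjoint (Set.Ioo I.1 I.2) (F : Set ℝ)}

/-- The ranked lengths of the interval components: `rankedLengths F j` is the `(j + 1)`-st largest
length, counted with multiplicity, and `0` if there are at most `j` components. -/
noncomputable def rankedLengths (F : Closeds ℝ) (j : ℕ) : ℝ :=
  sSup {x : ℝ | 0 < x ∧ ((j + 1 : ℕ) : ℕ∞) ≤ {I ∈ gaps F | x ≤ I.2 - I.1}.encard}

/-! All three statements rest on one fact: a decrement matrix `q` is determined by its diagonal
(`IsDecrementMatrix.eq_of_diag_eq`). Suppose that two such matrices agree in row `n`, and let `d` be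
the difference of their rows `n + 1`, with `d (n + 1) = 0`. Subtracting the recursions gives `(m +
1) d (m + 1) + (n + 1 - m) d m = - d 1 * q n m`. After division by binomial coefficients with
alternating signs the left side telescopes, and the result is `d 1 = d 1 * ∑ (-1)^m q n m / (n
choose m)`. As `∑ q n m = 1`, the sum on the right is less than `1` unless row `n` is concentrated
at `m = n`; for `n ≥ 2` the recursion then forces `q (n + 1) 1 = 0` in both matrices. Hence `d 1 =
0`, and so `d = 0`.

Compositions: `q n m` is the probability that `C n` has first part `m`. A discarded ball leaves a
first part `m` if it came from a first box of size `m + 1`, if it lay behind a first box of size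
`m`, or if it was a first box of size `1` followed by one of size `m`. Regeneration factorises the
last probability, which gives the recursion. The diagonal is the probability that all balls share
one box, and this does not depend on the order of the boxes. Peeling off first parts recovers the
law of each `C n`; the common cotransition probabilities then give the law of the sequence.

Sets: let `]a, b[` be the gap around a uniform point, and let `M i k` be the mean of `(b - a)^i (1 -
b)^k` (`meanGapMoment`). Splitting `1 = (b - a) + (1 - b) + a`, and regenerating at a second uniform
point for the term `a`, gives `M i k = M (i + 1) k + M i (k + 1) + M 0 (i + k + 1) * M i k`. Up to
binomial factors this is the recursion of a decrement matrix, whose diagonal consists of the moments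
`M n 0`, the expected power sums of the ranked lengths. So the ranked lengths determine all `M (i +
1) k`, hence by Stone–Weierstrass the length-biased law of `(b - a, 1 - b)` (`gapLaw`), hence the
probability that a given interval is avoided (`measure_not_hits`). Regeneration at the leftmost end
point extends this to finite families of intervals (`measure_avoids_eq`), and these events determine
the law of the set. -/

/-! ### Decrement matrices -/

/-- The laws `q n` of the first part of a regenerative composition of `n`. -/
structure IsDecrementMatrix (q : ℕ → ℕ → ℝ) : Prop where
  nonneg : ∀ n m : ℕ, 0 ≤ q n m
  sum_eq_one : ∀ n : ℕ, 1 ≤ n → ∑ m ∈ Finset.Icc 1 n, q n m = 1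
  recursion : ∀ n m : ℕ, 2 ≤ m → m ≤ n →
    (n + 1 : ℝ) * q n m =
      (m + 1) * q (n + 1) (m + 1) + (n + 1 - m) * q (n + 1) m + q (n + 1) 1 * q n m

/-- After a shift of the index the coefficient `m` from the first term cancels the `-m` of the
second, up to boundary terms. It serves to sum the recursion over a row. -/
lemma sum_succ_mul_add_sub_mul (a : ℕ → ℝ) (N : ℝ) (n : ℕ) :
    ∑ m ∈ Finset.Icc 1 n, ((m + 1) * a (m + 1) + (N - m) * a m) =
      N * ∑ m ∈ Finset.Icc 1 n, a m + (n + 1) * a (n + 1) - a 1 := by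
  induction n with
  | zero => simp
  | succ n ih =>
    rw [Finset.sum_Icc_succ_top (by omega), ih, Finset.sum_Icc_succ_top (by omega)]
    push_cast
    ring

namespace IsDecrementMatrix

variable {q q' : ℕ → ℕ → ℝ}

/-- The recursion for `m = 1` follows from the others by summation. -/
lemma recursion' (h : IsDecrementMatrix q) {n m : ℕ} (hm : 1 ≤ m) (hmn : m ≤ n) :
    (n + 1 : ℝ) * q n m =
      (m + 1) * q (n + 1) (m + 1) + (n + 1 - m) * q (n + 1) m + q (n + 1) 1 * q n m := by
  rcases hm.eq_or_lt with rfl | hm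
  -- Summed over `m`, both sides equal `n + 1`, because rows `n` and `n + 1` have total mass `1`;
  -- cancelling the terms with `m ≥ 2` leaves `m = 1`.
  · have key : ∑ m ∈ Finset.Icc 1 n, ((n + 1 : ℝ) * q n m) =
        ∑ m ∈ Finset.Icc 1 n, ((m + 1) * q (n + 1) (m + 1) + (n + 1 - m) * q (n + 1) m +
          q (n + 1) 1 * q n m) := by
      have h1 := h.sum_eq_one (n + 1) (by omega)
      rw [Finset.sum_Icc_succ_top (by omega)] at h1
      rw [Finset.sum_add_distrib, sum_succ_mul_add_sub_mul (q (n + 1)) (n + 1) n,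
        ← Finset.mul_sum, ← Finset.mul_sum, h.sum_eq_one n hmn]
      linear_combination -(n + 1 : ℝ) * h1
    rw [← Finset.add_sum_Ioc_eq_sum_Icc hmn, ← Finset.add_sum_Ioc_eq_sum_Icc hmn,
      Finset.sum_congr rfl fun m hm => h.recursion n m (Finset.mem_Ioc.1 hm).1
        (Finset.mem_Ioc.1 hm).2] at key
    exact add_right_cancel key
  · exact h.recursion n m hm hmn

/-- At `m = n` the recursion reads `n + 1 = (n + 1) q (n+1) (n+1) + q (n+1) n + q (n+1) 1`. The
three entries have sum at most `1`, and for `n ≥ 2` their positions are distinct, so all mass must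
sit on the one with coefficient `n + 1`. This settles the degenerate case of the telescoping
argument. -/
lemma eq_zero_of_diag_eq_one (h : IsDecrementMatrix q) {n : ℕ} (hn : 2 ≤ n) (h1 : q n n = 1) :
    q (n + 1) 1 = 0 := by
  have hr := h.recursion n n hn le_rfl
  rw [h1] at hr
  have hs := h.sum_eq_one (n + 1) (by omega)
  have hle : q (n + 1) 1 + q (n + 1) n + q (n + 1) (n + 1) ≤ 1 := by
    rw [← hs]
    have hsub : ({1, n, n + 1} : Finset ℕ) ⊆ Finset.Icc 1 (n + 1) := by
      intro x hx
      simp only [Finset.mem_insert, Finset.mem_singleton] at hx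
      rw [Finset.mem_Icc]
      omega
    refine le_trans (le_of_eq ?_)
      (Finset.sum_le_sum_of_subset_of_nonneg hsub fun i _ _ => h.nonneg _ i)
    rw [Finset.sum_insert (by simp; omega), Finset.sum_pair (by omega)]
    ring
  have a1 := h.nonneg (n + 1) 1
  have a2 := h.nonneg (n + 1) n
  have a3 := h.nonneg (n + 1) (n + 1)
  have hn' : (2 : ℝ) ≤ n := by exact_mod_cast hn
  nlinarith

/-- The differences of two solutions of the recursion vanish. -/
lemma difference_eq_zero {r d : ℕ → ℝ} {n : ℕ} (hn : 1 ≤ n) (hr : ∀ m, 0 ≤ r m)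
    (hsum : ∑ m ∈ Finset.Icc 1 n, r m = 1) (hdeg : 2 ≤ n → r n = 1 → d 1 = 0)
    (hd : d (n + 1) = 0)
    (hrec : ∀ m : ℕ, 1 ≤ m → m ≤ n →
      (m + 1) * d (m + 1) + (n + 1 - m : ℝ) * d m + d 1 * r m = 0) :
    ∀ m, 1 ≤ m → m ≤ n + 1 → d m = 0 := by
  -- Since `(m+1) (n+1 choose m+1) = (n+1-m) (n+1 choose m) = (n+1) (n choose m)`, this
  -- normalisation turns the two-term combination in `hrec` into a difference `e m - e (m + 1)`.
  set e : ℕ → ℝ := fun m => (-1) ^ m * d m / (n + 1).choose m with he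
  have hde : ∀ m, m ≤ n + 1 → d m = (-1) ^ m * (n + 1).choose m * e m := by
    intro m hm
    have : ((n + 1).choose m : ℝ) ≠ 0 := by
      exact_mod_cast (Nat.choose_pos hm).ne'
    simp only [he]
    field_simp
    rw [← pow_mul, mul_comm m 2, pow_mul]
    simp
  have hstep : ∀ m, 1 ≤ m → m ≤ n →
      e m - e (m + 1) = -(d 1 / (n + 1)) * ((-1) ^ m * r m / n.choose m) := by
    intro m hm hmn
    have h1 := hrec m hm hmn
    have c0 : (n.choose m : ℝ) ≠ 0 := by exact_mod_cast (Nat.choose_pos hmn).ne'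
    have c1 : ((m : ℝ) + 1) * (n + 1).choose (m + 1) = (n + 1) * n.choose m := by
      have := Nat.add_one_mul_choose_eq n m
      rw [mul_comm]
      exact_mod_cast this.symm
    have c2 : ((n : ℝ) + 1 - m) * (n + 1).choose m = (n + 1) * n.choose m := by
      have := Nat.choose_mul_succ_eq n m
      have h3 : ((n + 1 - m : ℕ) : ℝ) = (n : ℝ) + 1 - m := by
        rw [Nat.cast_sub (by omega)]; push_cast; ring
      rw [← h3, mul_comm, mul_comm ((n : ℝ) + 1)]
      exact_mod_cast this.symm
    have h2 : ((-1 : ℝ) ^ m) * (-1) ^ m = 1 := by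
      rw [← pow_add, ← two_mul, pow_mul]; simp
    rw [hde m (by omega), hde (m + 1) (by omega)] at h1
    have h3 : ((n : ℝ) + 1) * n.choose m * (e m - e (m + 1)) = - d 1 * (-1) ^ m * r m := by
      have : ((-1 : ℝ) ^ m) * ((m + 1) * ((-1) ^ (m + 1) * (n + 1).choose (m + 1) * e (m + 1)) +
          (n + 1 - m : ℝ) * ((-1) ^ m * (n + 1).choose m * e m) + d 1 * r m) = 0 := by
        rw [h1, mul_zero]
      rw [pow_succ] at this
      linear_combination this + ((-1) ^ m * (-1) ^ m * e (m + 1)) * c1 -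
        ((-1) ^ m * (-1) ^ m * e m) * c2 - ((n : ℝ) + 1) * n.choose m * (e m - e (m + 1)) * h2
    have hn1 : (n : ℝ) + 1 ≠ 0 := by positivity
    field_simp
    linear_combination h3
  have he_last : e (n + 1) = 0 := by simp [he, hd]
  have he1 : e 1 = -(d 1 / (n + 1)) := by simp [he]; ring
  have htel : e 1 = -(d 1 / (n + 1)) * ∑ m ∈ Finset.Icc 1 n, ((-1) ^ m * r m / n.choose m) := by
    rw [Finset.mul_sum, Finset.sum_congr rfl fun m hm =>
      (hstep m (Finset.mem_Icc.1 hm).1 (Finset.mem_Icc.1 hm).2).symm]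
    have : ∀ k, ∑ m ∈ Finset.Icc 1 k, (e m - e (m + 1)) = e 1 - e (k + 1) := by
      intro k
      induction k with
      | zero => simp
      | succ k ih => rw [Finset.sum_Icc_succ_top (by omega), ih]; ring
    rw [this, he_last, sub_zero]
  have hd1 : d 1 = 0 := by
    by_contra hne
    -- As `e 1 = -(d 1 / (n + 1))` too, a nonzero `d 1` cancels from the telescoped identity. The
    -- signed, damped sum then equals `∑ r m = 1`, so equality holds term by term.
    have hS : ∑ m ∈ Finset.Icc 1 n, ((-1) ^ m * r m / n.choose m) = 1 := by
      rw [he1] at htel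
      have : -(d 1 / ((n : ℝ) + 1)) ≠ 0 := by
        have : (n : ℝ) + 1 ≠ 0 := by positivity
        simp [hne, this]
      field_simp at htel
      linarith
    have hle : ∀ m ∈ Finset.Icc 1 n, 0 ≤ r m - (-1) ^ m * r m / n.choose m := by
      intro m hm
      have c0 : (1 : ℝ) ≤ n.choose m := by
        exact_mod_cast Nat.choose_pos (Finset.mem_Icc.1 hm).2
      have hr0 := hr m
      rw [sub_nonneg, div_le_iff₀ (by linarith)]
      rcases neg_one_pow_eq_or ℝ m with h | h <;> rw [h] <;> nlinarith
    have h0 := (Finset.sum_eq_zero_iff_of_nonneg hle).1 (by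
      rw [Finset.sum_sub_distrib, hS, hsum, sub_self])
    -- Strictly between `0` and `n` the binomial coefficient is at least `2`, so equality of the
    -- terms kills `r m`.
    have hzero : ∀ m ∈ Finset.Icc 1 n, m ≠ n → r m = 0 := by
      intro m hm hmn
      have h1 := h0 m hm
      rw [Finset.mem_Icc] at hm
      have c0 : (2 : ℝ) ≤ n.choose m := by
        have : 2 ≤ n.choose m := by
          rw [Nat.succ_le_iff, Nat.one_lt_iff_ne_zero_and_ne_one]
          refine ⟨(Nat.choose_pos hm.2).ne', ?_⟩
          rw [Ne, Nat.choose_eq_one_iff]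
          omega
        exact_mod_cast this
      have hr0 := hr m
      rw [sub_eq_zero, eq_div_iff (by linarith)] at h1
      rcases neg_one_pow_eq_or ℝ m with h | h <;> rw [h] at h1 <;> nlinarith
    have hrn : r n = 1 := by
      rw [← hsum]
      refine (Finset.sum_eq_single n (fun m hm hne => hzero m hm hne) ?_).symm
      intro h
      exact absurd (Finset.mem_Icc.2 ⟨hn, le_rfl⟩) h
    -- For `n = 1` the sign `(-1)^1` already contradicts equality; for `n ≥ 2` the degenerate case
    -- is excluded by `hdeg`.
    rcases hn.eq_or_lt with rfl | hn2
    · have := h0 1 (by simp)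
      simp only [hrn] at this
      norm_num at this
    · exact hne (hdeg hn2 hrn)
  -- With `d 1 = 0` the sequence `e` is constant on `1, …, n + 1`, and it vanishes at the top end.
  have hback : ∀ k, k ≤ n → e (n + 1 - k) = 0 := by
    intro k
    induction k with
    | zero => intro _; simpa using he_last
    | succ k ih =>
      intro hk
      have h1 := hstep (n - k) (by omega) (by omega)
      rw [hd1] at h1
      have h2 := ih (by omega)
      rw [show n + 1 - k = n - k + 1 by omega] at h2
      rw [show n + 1 - (k + 1) = n - k by omega]
      rw [h2] at h1
      simpa using h1
  intro m hm hmn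
  have h1 := hback (n + 1 - m) (by omega)
  rw [show n + 1 - (n + 1 - m) = m by omega] at h1
  rw [hde m hmn, h1, mul_zero]

/-- A decrement matrix is determined by its diagonal. -/
theorem eq_of_diag_eq (h : IsDecrementMatrix q) (h' : IsDecrementMatrix q')
    (hdiag : ∀ n, 1 ≤ n → q n n = q' n n) :
    ∀ n m, 1 ≤ m → m ≤ n → q n m = q' n m := by
  intro n
  induction n with
  | zero => intro m h1 h2; omega
  | succ n ih =>
    intro m hm hmn
    rcases n.eq_zero_or_pos with rfl | hn
    · obtain rfl : m = 1 := by omega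
      exact hdiag 1 le_rfl
    -- The rows `n` agree by induction, so subtracting the two recursions for row `n + 1` leaves a
    -- linear relation with the common row as coefficients.
    refine sub_eq_zero.1 (difference_eq_zero (r := q n)
      (d := fun m => q (n + 1) m - q' (n + 1) m) hn (h.nonneg n) (h.sum_eq_one n hn) ?_ ?_ ?_ m hm hmn)
    · intro hn2 h1
      have h2 : q' n n = 1 := by rw [← hdiag n hn, h1]
      simp [h.eq_zero_of_diag_eq_one hn2 h1, h'.eq_zero_of_diag_eq_one hn2 h2]
    · simp [hdiag (n + 1) (by omega)]
    · intro m hm hmn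
      have e1 := h.recursion' hm hmn
      have e2 := h'.recursion' hm hmn
      rw [← ih m hm hmn] at e2
      linear_combination e2 - e1

end IsDecrementMatrix

/-! ### Discarding a ball from a composition; the one-part composition -/

namespace Composition

lemma sum_filter_pos (l : List ℕ) : (l.filter (fun m => 0 < m)).sum = l.sum := by
  induction l with
  | nil => rfl
  | cons a l ih =>
    rcases a.eq_zero_or_pos with rfl | ha
    · simpa using ih
    · simp [ha, ih]

lemma sum_modify_sub_one (l : List ℕ) (j : ℕ) (hj : j < l.length) (hl : ∀ a ∈ l, 0 < a) :
    (l.modify j (fun m => m - 1)).sum + 1 = l.sum := by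
  induction l generalizing j with
  | nil => simp at hj
  | cons a l ih =>
    cases j with
    | zero =>
      have := hl a (by simp)
      simp only [List.modify_zero_cons, List.sum_cons]
      omega
    | succ j =>
      have := ih j (by simpa using hj) (fun b hb => hl b (by simp [hb]))
      simp only [List.modify_succ_cons, List.sum_cons]
      omega

/-- The composition left when ball `i` is discarded. -/
def discard {n : ℕ} (c : Composition (n + 1)) (i : Fin (n + 1)) : Composition n where
  blocks := c.discardBall i
  blocks_pos := by
    intro m hm
    simpa using (List.mem_filter.1 hm).2
  blocks_sum := by
    have h := sum_modify_sub_one c.blocks (c.index i) (c.index i).2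
      (fun a ha => c.blocks_pos ha)
    rw [discardBall, sum_filter_pos]
    rw [c.blocks_sum] at h
    omega

/-- The first box holds exactly the balls with number less than `h`, so only their removal changes
it; it is deleted when it held a single ball. -/
lemma head?_discardBall {n h : ℕ} {t : List ℕ} (c : Composition n) (hc : c.blocks = h :: t)
    (i : Fin n) :
    (c.discardBall i).head? =
      if (i : ℕ) < h then (if h = 1 then t.head? else some (h - 1)) else some h := by
  have hpos : ∀ a ∈ h :: t, 0 < a := fun a ha => c.blocks_pos (hc ▸ ha)
  have hh : 0 < h := hpos h (by simp)
  have hidx : (c.index i : ℕ) = 0 ↔ (i : ℕ) < h := by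
    have hs : c.sizeUpTo 1 = h := by simp [sizeUpTo, hc]
    constructor
    · intro h0
      have := c.lt_sizeUpTo_index_succ i
      simpa [h0, hs] using this
    · intro hi
      by_contra hne
      have h1 : c.sizeUpTo 1 ≤ c.sizeUpTo (c.index i) := c.monotone_sizeUpTo (by omega)
      have h2 := c.sizeUpTo_index_le i
      omega
  rw [discardBall, hc]
  split_ifs with h1 h2
  · rw [hidx.2 h1, List.modify_zero_cons, h2]
    rw [List.filter_cons_of_neg (by simp), List.filter_eq_self.2]
    intro a ha
    simpa using hpos a (by simp [ha])
  · rw [hidx.2 h1, List.modify_zero_cons, List.filter_cons_of_pos (by simp; omega)]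
    rfl
  · obtain ⟨k, hk⟩ := Nat.exists_eq_succ_of_ne_zero (fun h0 => h1 (hidx.1 h0))
    rw [hk, Nat.succ_eq_add_one, List.modify_succ_cons, List.filter_cons_of_pos (by simpa using hh)]
    rfl

/-- The number of balls whose removal leaves a first box of size `m`. -/
lemma ncard_head?_discardBall {n m : ℕ} (hm : 1 ≤ m) (c : Composition (n + 1)) :
    ({i : Fin (n + 1) | (c.discardBall i).head? = some m}.ncard : ℝ) =
      (if c.blocks.head? = some (m + 1) then (m + 1 : ℝ) else 0) +
      (if c.blocks.head? = some m then (n + 1 - m : ℝ) else 0) +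
      (if c.blocks.head? = some 1 ∧ c.blocks.tail.head? = some m then 1 else 0) := by
  obtain ⟨h, t, hc⟩ : ∃ h t, c.blocks = h :: t := by
    cases hb : c.blocks with
    | nil => have := c.blocks_sum; simp [hb] at this
    | cons h t => exact ⟨h, t, rfl⟩
  have hh : 0 < h := c.blocks_pos (by simp [hc])
  have hsum : h + t.sum = n + 1 := by have := c.blocks_sum; simpa [hc] using this
  have hlt : {i : Fin (n + 1) | (i : ℕ) < h}.ncard = h := by
    rw [Set.ncard_eq_toFinset_card', Set.toFinset_ofPred, Fin.card_filter_val_lt]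
    omega
  have hge : ({i : Fin (n + 1) | ¬ (i : ℕ) < h}.ncard : ℝ) = n + 1 - h := by
    have := Set.ncard_add_ncard_compl {i : Fin (n + 1) | (i : ℕ) < h}
    rw [hlt, Nat.card_eq_fintype_card, Fintype.card_fin] at this
    rw [eq_sub_iff_add_eq, add_comm]
    exact_mod_cast this
  simp only [head?_discardBall c hc, hc, List.head?_cons, List.tail_cons, Option.some.injEq]
  -- A first box of size `1` vanishes with its ball and exposes the second box; only in this case
  -- does the tail matter.
  by_cases h1 : h = 1
  · subst h1
    have hm1 : ¬ (1 = m + 1) := by omega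
    simp only [if_true, hm1, if_false, true_and, zero_add]
    by_cases hmm : 1 = m
    · subst hmm
      by_cases ht : t.head? = some 1
      · have : {i : Fin (n + 1) | (if (i : ℕ) < 1 then t.head? else some 1) = some 1} =
            Set.univ := by
          ext i; simp [ht]
        rw [this, Set.ncard_univ, Nat.card_eq_fintype_card, Fintype.card_fin]
        simp [ht]
      · have : {i : Fin (n + 1) | (if (i : ℕ) < 1 then t.head? else some 1) = some 1} =
            {i : Fin (n + 1) | ¬ (i : ℕ) < 1} := by
          ext i
          simp only [Set.mem_ofPred_eq]
          split_ifs with hi <;> simp [ht, hi]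
        rw [this, hge]
        simp [ht]
    · by_cases ht : t.head? = some m
      · have : {i : Fin (n + 1) | (if (i : ℕ) < 1 then t.head? else some 1) = some m} =
            {i : Fin (n + 1) | (i : ℕ) < 1} := by
          ext i
          simp only [Set.mem_ofPred_eq]
          split_ifs with hi <;> simp [ht, hi, hmm]
        rw [this, hlt]
        simp [ht, hmm]
      · have : {i : Fin (n + 1) | (if (i : ℕ) < 1 then t.head? else some 1) = some m} = ∅ := by
          ext i
          simp only [Set.mem_ofPred_eq, Set.mem_empty_iff_false, iff_false]
          split_ifs with hi <;> simp [ht, hmm]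
        rw [this]
        simp [ht, hmm]
  · simp only [h1, if_false, false_and, add_zero]
    by_cases h2 : h = m + 1
    · have : {i : Fin (n + 1) | (if (i : ℕ) < h then some (h - 1) else some h) = some m} =
            {i : Fin (n + 1) | (i : ℕ) < h} := by
        ext i
        simp only [Set.mem_ofPred_eq]
        split_ifs with hi <;> simp [hi] <;> omega
      rw [this, hlt]
      simp [h2]
    · by_cases h3 : h = m
      · have : {i : Fin (n + 1) | (if (i : ℕ) < h then some (h - 1) else some h) = some m} =
            {i : Fin (n + 1) | ¬ (i : ℕ) < h} := by
          ext i
          simp only [Set.mem_ofPred_eq]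
          split_ifs with hi <;> simp [hi] <;> omega
        rw [this, hge]
        simp [h3]
      · have : {i : Fin (n + 1) | (if (i : ℕ) < h then some (h - 1) else some h) = some m} =
            ∅ := by
          ext i
          simp only [Set.mem_ofPred_eq, Set.mem_empty_iff_false, iff_false]
          split_ifs with hi <;> simp <;> omega
        rw [this]
        simp [h2, h3]

lemma head?_eq_some_iff_eq_single {n : ℕ} (hn : 0 < n) (c : Composition n) :
    c.blocks.head? = some n ↔ c = Composition.single n hn := by
  constructor
  · intro h
    rw [Composition.ext_iff, single_blocks]
    cases hb : c.blocks with
    | nil => simp [hb] at h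
    | cons a t =>
      obtain rfl : a = n := by simpa [hb] using h
      have hs : a + t.sum = a := by have := c.blocks_sum; simpa [hb] using this
      cases t with
      | nil => rfl
      | cons b t =>
        have : 0 < b := c.blocks_pos (by simp [hb])
        simp at hs
        omega
  · rintro rfl
    simp

/-- A multiset with one element has only one ordering, so forgetting the order loses nothing about
the one-part composition. This makes the diagonal visible in the partition structure. -/
lemma ofComposition_eq_iff {n : ℕ} (hn : 0 < n) (c : Composition n) :
    Nat.Partition.ofComposition n c = Nat.Partition.ofComposition n (Composition.single n hn) ↔
      c = Composition.single n hn := by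
  refine ⟨fun h => ?_, fun h => by rw [h]⟩
  have h1 := congrArg Nat.Partition.parts h
  simp only [Nat.Partition.ofComposition_parts, single_blocks] at h1
  rw [Composition.ext_iff, single_blocks]
  exact List.perm_singleton.1 (Multiset.coe_eq_coe.1 h1)

/-- Every box contains a ball, so two boxes would give two inequivalent labels, whatever the
labelling. -/
lemma ker_index_perm_eq_top_iff {n : ℕ} (hn : 0 < n) (c : Composition n)
    (σ : Equiv.Perm (Fin n)) :
    Setoid.ker (fun i => c.index (σ i)) = ⊤ ↔ c = Composition.single n hn := by
  have hpos : 0 < c.length := c.length_pos_of_pos hn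
  have hsurj : Function.Surjective c.index := fun j => by
    refine ⟨c.embedding j ⟨0, c.one_le_blocksFun j⟩, c.index_embedding _ _⟩
  rw [eq_single_iff_length hn]
  constructor
  · intro h
    by_contra hne
    obtain ⟨x, hx⟩ := hsurj ⟨0, hpos⟩
    obtain ⟨y, hy⟩ := hsurj ⟨1, by omega⟩
    have : (Setoid.ker (fun i => c.index (σ i))) (σ.symm x) (σ.symm y) := by
      rw [h]; trivial
    rw [Setoid.ker_def] at this
    simp [hx, hy] at this
  · intro h
    ext i j
    have : Subsingleton (Fin c.length) := by rw [h]; infer_instance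
    simp only [Setoid.ker_def, Setoid.top_def, Pi.top_apply, Prop.top_eq_true, iff_true]
    exact Subsingleton.elim _ _

end Composition

/-! ### Regenerative composition structures and their first parts -/

section CompositionStructure

variable {Ω Ω₁ Ω₂ : Type*} [MeasurableSpace Ω] [MeasurableSpace Ω₁] [MeasurableSpace Ω₂]

instance (n : ℕ) : DiscreteMeasurableSpace (Composition n) := ⟨fun _ => trivial⟩

/-- The balls are sorted by the composition that their removal leaves; this sums the cotransition
numerators over an event. -/
lemma ncard_discardBall_eq_sum {n : ℕ} (c : Composition (n + 1)) (A : Set (Composition n))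
    [DecidablePred (· ∈ A)] :
    ∑ d : Composition n, (if d ∈ A then
        ({i : Fin (n + 1) | c.discardBall i = d.blocks}.ncard : ℝ) else 0) =
      {i : Fin (n + 1) | c.discard i ∈ A}.ncard := by
  classical
  rw [← Finset.sum_filter, Set.ncard_eq_toFinset_card', Set.toFinset_ofPred]
  rw [Finset.card_eq_sum_card_fiberwise (f := c.discard) (t := Finset.univ.filter (· ∈ A))
    (fun i hi => by simpa using hi)]
  push_cast
  refine Finset.sum_congr rfl fun d hd => ?_
  rw [Set.ncard_eq_toFinset_card', Set.toFinset_ofPred, Finset.filter_filter]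
  congr 2
  ext i
  simp only [Finset.mem_filter, Finset.mem_univ, true_and] at hd ⊢
  constructor
  · intro h
    have : c.discard i = d := Composition.ext h
    exact ⟨this ▸ hd, this⟩
  · rintro ⟨-, rfl⟩
    rfl

variable {μ : Measure Ω} {C : (n : ℕ) → Ω → Composition n}

lemma measureReal_mem_eq_sum [IsProbabilityMeasure μ] (hC : IsCompositionStructure μ C) (n : ℕ) (A : Set (Composition n))
    [DecidablePred (· ∈ A)] :
    μ.real {ω | C n ω ∈ A} = ∑ d : Composition n, if d ∈ A then μ.real {ω | C n ω = d} else 0 := by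
  rw [← Finset.sum_filter]
  have := MeasureTheory.measureReal_biUnion_finset (μ := μ) (s := Finset.univ.filter (· ∈ A))
    (f := fun d => {ω | C n ω = d}) (fun d _ e _ hde => by
      refine Set.disjoint_left.2 fun ω h1 h2 => hde ?_
      exact (Set.mem_ofPred.1 h1).symm.trans h2)
    (fun d _ => hC.measurable n (MeasurableSet.of_discrete (s := {d})))
  rw [← this]
  congr 1
  ext ω
  simp

lemma IsCompositionStructure.measureReal_eq_sum [IsProbabilityMeasure μ] (hC : IsCompositionStructure μ C) (n : ℕ)
    (d : Composition n) :
    (n + 1 : ℝ) * μ.real {ω | C n ω = d} = ∑ c : Composition (n + 1),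
      ({i : Fin (n + 1) | c.discardBall i = d.blocks}.ncard : ℝ) * μ.real {ω | C (n + 1) ω = c} := by
  classical
  have h1 : μ.real {ω | C n ω = d} = ∑ c : Composition (n + 1),
      μ.real ({ω | C n ω = d} ∩ {ω | C (n + 1) ω = c}) := by
    have := MeasureTheory.measureReal_biUnion_finset (μ := μ)
      (s := (Finset.univ : Finset (Composition (n + 1))))
      (f := fun c => {ω | C n ω = d} ∩ {ω | C (n + 1) ω = c}) (fun c _ e _ hde => by
        refine Set.disjoint_left.2 fun ω h1 h2 => hde ?_
        exact (Set.mem_ofPred.1 h1.2).symm.trans h2.2)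
      (fun c _ => (hC.measurable n (MeasurableSet.of_discrete (s := {d}))).inter
        (hC.measurable (n + 1) (MeasurableSet.of_discrete (s := {c}))))
    rw [← this]
    congr 1
    ext ω
    simp
  rw [h1, Finset.mul_sum]
  refine Finset.sum_congr rfl fun c _ => ?_
  -- The sampling rule takes a whole family of compositions; with `k = 0` only the entries at `n`
  -- and `n + 1` matter, so the others are set to a default value.
  have h2 := hC.sampling n 0 (fun j => if h : j = n then h ▸ d else
    if h : j = n + 1 then h ▸ c else default)
  have e1 : {ω | C n ω = d} ∩ {ω | C (n + 1) ω = c} = {ω | ∀ j ∈ Set.Icc n (n + 1 + 0), C j ω =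
      (if h : j = n then h ▸ d else if h : j = n + 1 then h ▸ c else default :
        Composition j)} := by
    ext ω
    simp only [Set.mem_inter_iff, Set.mem_ofPred_eq]
    constructor
    · rintro ⟨h1, h2⟩ j hj
      have : j = n ∨ j = n + 1 := by rw [Set.mem_Icc] at hj; omega
      rcases this with rfl | rfl
      · simpa using h1
      · simpa using h2
    · intro h
      exact ⟨by simpa using h n (by simp), by simpa using h (n + 1) (by simp)⟩
  have e2 : {ω | C (n + 1) ω = c} = {ω | ∀ j ∈ Set.Icc (n + 1) (n + 1 + 0), C j ω =
      (if h : j = n then h ▸ d else if h : j = n + 1 then h ▸ c else default :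
        Composition j)} := by
    ext ω
    simp
  rw [← e1, ← e2] at h2
  rw [measureReal_def, measureReal_def, h2, ENNReal.toReal_mul]
  simp only [dite_true, Nat.add_eq_left, one_ne_zero, dite_false]
  rw [cotransition, ENNReal.toReal_div, ENNReal.toReal_natCast, ENNReal.toReal_natCast]
  push_cast
  field_simp

/-- The laws of the first parts of a regenerative composition structure. -/
noncomputable def firstPartLaw (μ : Measure Ω) (C : (n : ℕ) → Ω → Composition n) (n m : ℕ) : ℝ :=
  μ.real {ω | (C n ω).blocks.head? = some m}

/-- The three terms come from counting the balls whose removal leaves a first box of size `m`.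
Regeneration is not involved: the last term is still a joint probability of the first two parts. -/
lemma IsCompositionStructure.firstPartLaw_recursion [IsProbabilityMeasure μ] (hC : IsCompositionStructure μ C) {n m : ℕ}
    (hm : 1 ≤ m) :
    (n + 1 : ℝ) * firstPartLaw μ C n m =
      (m + 1) * firstPartLaw μ C (n + 1) (m + 1) + (n + 1 - m) * firstPartLaw μ C (n + 1) m +
      μ.real {ω | (C (n + 1) ω).blocks.head? = some 1 ∧
        (C (n + 1) ω).blocks.tail.head? = some m} := by
  classical
  have e0 := measureReal_mem_eq_sum hC n {d | d.blocks.head? = some m}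
  have e1 := measureReal_mem_eq_sum hC (n + 1) {d | d.blocks.head? = some (m + 1)}
  have e2 := measureReal_mem_eq_sum hC (n + 1) {d | d.blocks.head? = some m}
  have e3 := measureReal_mem_eq_sum hC (n + 1) {d | d.blocks.head? = some 1 ∧
    d.blocks.tail.head? = some m}
  simp only [Set.mem_ofPred_eq] at e0 e1 e2 e3
  simp only [firstPartLaw]
  rw [e0, e1, e2, e3, Finset.mul_sum, Finset.mul_sum, Finset.mul_sum,
    ← Finset.sum_add_distrib, ← Finset.sum_add_distrib]
  calc _ = ∑ d : Composition n, ∑ c : Composition (n + 1), (if d ∈ {d | d.blocks.head? = some m}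
          then ({i : Fin (n + 1) | c.discardBall i = d.blocks}.ncard : ℝ) else 0) *
          μ.real {ω | C (n + 1) ω = c} := by
        refine Finset.sum_congr rfl fun d _ => ?_
        simp only [Set.mem_ofPred_eq]
        split_ifs with h
        · rw [hC.measureReal_eq_sum]
        · simp
    _ = _ := by
        rw [Finset.sum_comm]
        refine Finset.sum_congr rfl fun c _ => ?_
        rw [← Finset.sum_mul, ncard_discardBall_eq_sum]
        have : {i : Fin (n + 1) | c.discard i ∈ {d : Composition n | d.blocks.head? = some m}} =
          {i : Fin (n + 1) | (c.discardBall i).head? = some m} := rfl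
        rw [this, Composition.ncard_head?_discardBall hm c, add_mul, add_mul]
        simp only [ite_mul, mul_ite, zero_mul, mul_zero, one_mul]

/-- The product form of regeneration, which remains true when the conditioning event is null. -/
lemma IsRegenerativeCompositionStructure.measure_head_tail [IsProbabilityMeasure μ]
    (hC : IsRegenerativeCompositionStructure μ C) {m k : ℕ} (hm : 1 ≤ m) (hk : 1 ≤ k)
    (c : Composition k) :
    μ.real {ω | (C (m + k) ω).blocks.head? = some m ∧ (C (m + k) ω).blocks.tail = c.blocks} =
      firstPartLaw μ C (m + k) m * μ.real {ω | C k ω = c} := by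
  by_cases h0 : μ {ω | (C (m + k) ω).blocks.head? = some m} = 0
  · rw [firstPartLaw, measureReal_def, measureReal_def, h0, measure_mono_null (fun ω h => h.1) h0]
    simp
  · have h1 := hC.regenerative m k hm hk h0 c
    have hmeas : MeasurableSet {ω | (C (m + k) ω).blocks.head? = some m} :=
      hC.measurable (m + k) (MeasurableSet.of_discrete (s := {d : Composition (m + k) | d.blocks.head? = some m}))
    rw [cond_apply hmeas] at h1
    have h2 : μ ({ω | (C (m + k) ω).blocks.head? = some m} ∩
        {ω | (C (m + k) ω).blocks.tail = c.blocks}) =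
        μ {ω | (C (m + k) ω).blocks.head? = some m} * μ {ω | C k ω = c} := by
      rw [← h1, ← mul_assoc, ENNReal.mul_inv_cancel h0 (measure_ne_top _ _), one_mul]
    rw [firstPartLaw, measureReal_def, measureReal_def, measureReal_def, ← ENNReal.toReal_mul, ← h2]
    rfl

/-- Regeneration behind a first part `1` factorises the probability that the first two parts are `1`
and `m`, which closes the recursion of the first-part laws. -/
lemma IsRegenerativeCompositionStructure.isDecrementMatrix [IsProbabilityMeasure μ]
    (hC : IsRegenerativeCompositionStructure μ C) : IsDecrementMatrix (firstPartLaw μ C) where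
  nonneg n m := measureReal_nonneg
  sum_eq_one n hn := by
    simp only [firstPartLaw]
    rw [← MeasureTheory.measureReal_biUnion_finset (μ := μ) (s := Finset.Icc 1 n)
      (f := fun m => {ω | (C n ω).blocks.head? = some m}) (fun d _ e _ hde => by
        refine Set.disjoint_left.2 fun ω h1 h2 => hde ?_
        exact Option.some.inj ((Set.mem_ofPred.1 h1).symm.trans h2))
      (fun m _ => hC.measurable n
        (MeasurableSet.of_discrete (s := {d : Composition n | d.blocks.head? = some m})))]
    rw [← probReal_univ (μ := μ)]
    congr 1
    ext ω
    simp only [Set.mem_iUnion, Set.mem_ofPred_eq, Set.mem_univ, iff_true, Finset.mem_Icc]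
    have hs := (C n ω).blocks_sum
    cases hb : (C n ω).blocks with
    | nil => simp [hb] at hs; omega
    | cons a t =>
      have : 0 < a := (C n ω).blocks_pos (by simp [hb])
      simp [hb] at hs
      exact ⟨a, ⟨by omega, by omega⟩, rfl⟩
  recursion n m hm hmn := by
    classical
    rw [hC.firstPartLaw_recursion (by omega : 1 ≤ m)]
    congr 1
    have e0 := measureReal_mem_eq_sum hC.toIsCompositionStructure n {d | d.blocks.head? = some m}
    simp only [Set.mem_ofPred_eq] at e0
    conv_rhs => rw [firstPartLaw, firstPartLaw, e0, Finset.mul_sum]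
    have hn : 1 ≤ n := by omega
    -- Regeneration is stated for compositions of `1 + n`, a type not syntactically that of
    -- compositions of `n + 1`; passing through a variable avoids casts.
    obtain ⟨N, hN⟩ : ∃ N, N = 1 + n := ⟨_, rfl⟩
    rw [show n + 1 = N by omega]
    subst hN
    calc _ = ∑ c ∈ Finset.univ.filter (fun c : Composition n => c.blocks.head? = some m),
          μ.real {ω | (C (1 + n) ω).blocks.head? = some 1 ∧
            (C (1 + n) ω).blocks.tail = c.blocks} := by
          rw [← MeasureTheory.measureReal_biUnion_finset]
          · congr 1
            ext ω
            simp only [Set.mem_iUnion, Set.mem_ofPred_eq, Finset.mem_filter, Finset.mem_univ,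
              true_and, exists_prop]
            constructor
            · rintro ⟨h1, h2⟩
              refine ⟨⟨(C (1 + n) ω).blocks.tail, fun {i} hi => (C (1 + n) ω).blocks_pos
                (List.mem_of_mem_tail hi), ?_⟩, h2, h1, rfl⟩
              have hs := (C (1 + n) ω).blocks_sum
              cases hb : (C (1 + n) ω).blocks with
              | nil => simp [hb] at h1
              | cons a t =>
                obtain rfl : a = 1 := by simpa [hb] using h1
                simp [hb] at hs
                simpa using hs
            · rintro ⟨c, h1, h2, h3⟩
              exact ⟨h2, by rw [h3, h1]⟩
          · intro c _ d _ hcd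
            refine Set.disjoint_left.2 fun ω h1 h2 => hcd (Composition.ext ?_)
            exact h1.2.symm.trans h2.2
          · intro c _
            exact hC.measurable (1 + n) (MeasurableSet.of_discrete (s := {d | d.blocks.head? =
              some 1 ∧ d.blocks.tail = c.blocks}))
      _ = _ := by
          rw [Finset.sum_filter]
          refine Finset.sum_congr rfl fun c _ => ?_
          rw [mul_ite, mul_zero, hC.measure_head_tail le_rfl hn]
          rfl

/-! ### Uniqueness for composition structures -/

variable {μ₁ : Measure Ω₁} {μ₂ : Measure Ω₂} [IsProbabilityMeasure μ₁] [IsProbabilityMeasure μ₂]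
  {C₁ : (n : ℕ) → Ω₁ → Composition n} {C₂ : (n : ℕ) → Ω₂ → Composition n}

/-- The first part has a prescribed law and the remainder is a smaller copy of the structure, so
peeling off first parts gives the probability of every composition. -/
lemma IsRegenerativeCompositionStructure.law_eq (h₁ : IsRegenerativeCompositionStructure μ₁ C₁)
    (h₂ : IsRegenerativeCompositionStructure μ₂ C₂)
    (hq : ∀ n m, 1 ≤ m → m ≤ n → firstPartLaw μ₁ C₁ n m = firstPartLaw μ₂ C₂ n m) (n : ℕ) :
    ∀ c : Composition n, μ₁.real {ω | C₁ n ω = c} = μ₂.real {ω | C₂ n ω = c} := by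
  induction n using Nat.strong_induction_on with
  | _ n ih =>
  intro c
  rcases n.eq_zero_or_pos with rfl | hn
  · have : Subsingleton (Composition 0) :=
      Fintype.card_le_one_iff_subsingleton.1 (by rw [composition_card]; norm_num)
    simp [Subsingleton.elim _ c]
  cases hb : c.blocks with
  | nil => have := c.blocks_sum; simp [hb] at this; omega
  | cons m t =>
    have hs : m + t.sum = n := by have := c.blocks_sum; simpa [hb] using this
    have hm : 0 < m := c.blocks_pos (by simp [hb])
    rcases (t.sum).eq_zero_or_pos with h0 | hk
    · obtain rfl : m = n := by omega
      have hc := (c.head?_eq_some_iff_eq_single hn).1 (by simp [hb])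
      have := hq m m hm le_rfl
      simp only [firstPartLaw, Composition.head?_eq_some_iff_eq_single hn] at this
      rwa [hc]
    · let c' : Composition t.sum := ⟨t, fun {i} hi => c.blocks_pos (by simp [hb, hi]), rfl⟩
      subst hs
      have key : ∀ d : Composition (m + t.sum), d = c ↔
          d.blocks.head? = some m ∧ d.blocks.tail = c'.blocks := by
        intro d
        rw [Composition.ext_iff, hb]
        cases d.blocks with
        | nil => simp
        | cons a s => simp [c']
      simp only [key]
      rw [h₁.measure_head_tail hm hk, h₂.measure_head_tail hm hk, hq _ _ hm (by omega),
        ih _ (by omega)]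

/-- Going down from the largest index, each step contributes a cotransition probability that is the
same for both structures; only the marginal law at the largest index remains. -/
lemma IsRegenerativeCompositionStructure.fdd_eq (h₁ : IsRegenerativeCompositionStructure μ₁ C₁)
    (h₂ : IsRegenerativeCompositionStructure μ₂ C₂)
    (hq : ∀ n m, 1 ≤ m → m ≤ n → firstPartLaw μ₁ C₁ n m = firstPartLaw μ₂ C₂ n m)
    (c : (j : ℕ) → Composition j) (d : ℕ) : ∀ n,
    μ₁ {ω | ∀ j ∈ Set.Icc n (n + d), C₁ j ω = c j} =
      μ₂ {ω | ∀ j ∈ Set.Icc n (n + d), C₂ j ω = c j} := by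
  induction d with
  | zero =>
    intro n
    have := h₁.law_eq h₂ hq n (c n)
    rw [measureReal_def, measureReal_def,
      ENNReal.toReal_eq_toReal_iff' (measure_ne_top _ _) (measure_ne_top _ _)] at this
    simpa using this
  | succ d ih =>
    intro n
    rw [show n + (d + 1) = n + 1 + d by omega, h₁.sampling, h₂.sampling, ih]

/-- The law of a regenerative composition structure is determined by the probabilities that the
compositions are trivial. -/
theorem IsRegenerativeCompositionStructure.identDistrib
    (h₁ : IsRegenerativeCompositionStructure μ₁ C₁)
    (h₂ : IsRegenerativeCompositionStructure μ₂ C₂)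
    (h : ∀ n (hn : 0 < n), μ₁ {ω | C₁ n ω = Composition.single n hn} =
      μ₂ {ω | C₂ n ω = Composition.single n hn}) :
    IdentDistrib (fun ω n => C₁ n ω) (fun ω n => C₂ n ω) μ₁ μ₂ := by
  have hq := h₁.isDecrementMatrix.eq_of_diag_eq h₂.isDecrementMatrix (fun n hn => by
    simp only [firstPartLaw, Composition.head?_eq_some_iff_eq_single hn]
    rw [measureReal_def, measureReal_def, h n hn])
  have m₁ : Measurable (fun ω n => C₁ n ω) := measurable_pi_iff.2 h₁.measurable
  have m₂ : Measurable (fun ω n => C₂ n ω) := measurable_pi_iff.2 h₂.measurable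
  refine ⟨m₁.aemeasurable, m₂.aemeasurable, ?_⟩
  have := Measure.isProbabilityMeasure_map (μ := μ₁) m₁.aemeasurable
  have := Measure.isProbabilityMeasure_map (μ := μ₂) m₂.aemeasurable
  -- Finite sets of indices lie in initial segments, and on these the coordinates take finitely many
  -- values, so it is enough to compare point masses.
  have key : ∀ N : ℕ, (μ₁.map (fun ω n => C₁ n ω)).map (Finset.Iic N).restrict =
      (μ₂.map (fun ω n => C₂ n ω)).map (Finset.Iic N).restrict := by
    intro N
    have r : Measurable ((Finset.Iic N).restrict (π := Composition)) :=
      Finset.measurable_restrict _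
    rw [Measure.map_map r m₁, Measure.map_map r m₂]
    refine Measure.ext_of_singleton fun x => ?_
    rw [Measure.map_apply (r.comp m₁) (measurableSet_singleton x),
      Measure.map_apply (r.comp m₂) (measurableSet_singleton x)]
    have := h₁.fdd_eq h₂ hq (fun j => if hj : j ∈ Finset.Iic N then x ⟨j, hj⟩ else default) N 0
    convert this using 2
    all_goals
      ext ω
      simp only [Set.mem_preimage, Set.mem_singleton_iff, Set.mem_ofPred_eq, Function.comp,
        funext_iff, Subtype.forall]
      refine forall_congr' fun j => ?_
      simp +contextual [Finset.restrict]
  refine IsProjectiveLimit.unique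
    (P := fun I : Finset ℕ => (μ₂.map (fun ω n => C₂ n ω)).map I.restrict) ?_ (fun I => rfl)
  intro I
  obtain ⟨N, hN⟩ : ∃ N, I ⊆ Finset.Iic N := by
    refine ⟨I.sup id, fun i hi => ?_⟩
    rw [Finset.mem_Iic]
    exact Finset.le_sup (f := id) hi
  have h2 : I.restrict (π := Composition) =
      Finset.restrict₂ hN ∘ (Finset.Iic N).restrict := rfl
  rw [h2, ← Measure.map_map (Finset.measurable_restrict₂ hN) (Finset.measurable_restrict _), key,
    Measure.map_map (Finset.measurable_restrict₂ hN) (Finset.measurable_restrict _)]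
  rfl

/-- Only the one-part composition can produce the one-block partition, and all its `n !` labellings
do so. -/
lemma PartitionCorrespondsTo.measure_single {Ω₀ : Type*} [MeasurableSpace Ω₀] {μ₀ : Measure Ω₀}
    {P : Ω₀ → Setoid ℕ} (h : PartitionCorrespondsTo μ₀ P μ C) (n : ℕ) (hn : 0 < n) :
    μ {ω | C n ω = Composition.single n hn} =
      μ₀ {ω | (P ω).comap (fun i : Fin n => (i : ℕ)) = ⊤} := by
  rw [h n ⊤, Finset.sum_eq_single (Composition.single n hn)]
  · simp only [Composition.ker_index_perm_eq_top_iff hn]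
    rw [Set.ofPred_true, Set.ncard_univ, Nat.card_perm, Nat.card_eq_fintype_card, Fintype.card_fin,
      ENNReal.div_self (by exact_mod_cast n.factorial_ne_zero) (ENNReal.natCast_ne_top _), mul_one]
  · intro c _ hc
    simp [Composition.ker_index_perm_eq_top_iff hn, hc]
  · simp

lemma InducesPartitionStructure.measure_single {p : (n : ℕ) → PMF n.Partition}
    (h : InducesPartitionStructure μ C p) (n : ℕ) (hn : 0 < n) :
    μ {ω | C n ω = Composition.single n hn} =
      p n (Nat.Partition.ofComposition n (Composition.single n hn)) := by
  rw [← h n]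
  simp only [Composition.ofComposition_eq_iff hn]

end CompositionStructure

/-! ### Closed subsets of the unit interval -/

/-- The first point of `F ∪ {1}` to the right of `x`. -/
noncomputable def nextPoint (F : Closeds ℝ) (x : ℝ) : ℝ := sInf (insert 1 ((F : Set ℝ) ∩ Set.Ioo x 1))

/-- The last point of `F ∪ {0}` to the left of `x`. -/
noncomputable def prevPoint (F : Closeds ℝ) (x : ℝ) : ℝ := sSup (insert 0 ((F : Set ℝ) ∩ Set.Ioo 0 x))

lemma bddBelow_nextPoint (F : Closeds ℝ) (x : ℝ) :
    BddBelow (insert 1 ((F : Set ℝ) ∩ Set.Ioo x 1)) := by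
  rw [bddBelow_insert]
  exact ⟨x, fun y hy => hy.2.1.le⟩

lemma bddAbove_prevPoint (F : Closeds ℝ) (x : ℝ) :
    BddAbove (insert 0 ((F : Set ℝ) ∩ Set.Ioo 0 x)) := by
  rw [bddAbove_insert]
  exact ⟨x, fun y hy => hy.2.2.le⟩

lemma nextPoint_le_one (F : Closeds ℝ) (x : ℝ) : nextPoint F x ≤ 1 :=
  csInf_le (bddBelow_nextPoint F x) (by simp)

lemma prevPoint_nonneg (F : Closeds ℝ) (x : ℝ) : 0 ≤ prevPoint F x :=
  le_csSup (bddAbove_prevPoint F x) (by simp)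

lemma le_nextPoint (F : Closeds ℝ) {x : ℝ} (hx : x ≤ 1) : x ≤ nextPoint F x := by
  refine le_csInf (by simp) ?_
  rintro y (rfl | hy)
  · exact hx
  · exact hy.2.1.le

lemma prevPoint_le (F : Closeds ℝ) {x : ℝ} (hx : 0 ≤ x) : prevPoint F x ≤ x := by
  refine csSup_le (by simp) ?_
  rintro y (rfl | hy)
  · exact hx
  · exact hy.2.2.le

/-- This expresses the point through hitting of open intervals, the events that generate the
σ-algebra; it is the source of measurability and of the scaling rules. -/
lemma nextPoint_lt_iff (F : Closeds ℝ) (x w : ℝ) :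
    nextPoint F x < w ↔ 1 < w ∨ ((F : Set ℝ) ∩ Set.Ioo x (min w 1)).Nonempty := by
  rw [nextPoint, csInf_lt_iff (bddBelow_nextPoint F x) (by simp)]
  constructor
  · rintro ⟨y, rfl | hy, hyw⟩
    · exact Or.inl hyw
    · exact Or.inr ⟨y, hy.1, hy.2.1, lt_min hyw hy.2.2⟩
  · rintro (h | ⟨y, hy, h1, h2⟩)
    · exact ⟨1, by simp, h⟩
    · rw [lt_min_iff] at h2
      exact ⟨y, Or.inr ⟨hy, h1, h2.2⟩, h2.1⟩

lemma lt_prevPoint_iff (F : Closeds ℝ) (x w : ℝ) :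
    w < prevPoint F x ↔ w < 0 ∨ ((F : Set ℝ) ∩ Set.Ioo (max w 0) x).Nonempty := by
  rw [prevPoint, lt_csSup_iff (bddAbove_prevPoint F x) (by simp)]
  constructor
  · rintro ⟨y, rfl | hy, hyw⟩
    · exact Or.inl hyw
    · exact Or.inr ⟨y, hy.1, max_lt hyw hy.2.1, hy.2.2⟩
  · rintro (h | ⟨y, hy, h1, h2⟩)
    · exact ⟨0, by simp, h⟩
    · rw [max_lt_iff] at h1
      exact ⟨y, Or.inr ⟨hy, h1.2, h2⟩, h1.1⟩

/-- Both sides say that `F` has a point in `]y, x[`. This exchange lets the left end point of a gap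
be written as the measure of a set of points `y`. -/
lemma nextPoint_lt_iff_lt_prevPoint (F : Closeds ℝ) {x y : ℝ} (hy : 0 ≤ y) (hx : x ≤ 1) :
    nextPoint F y < x ↔ y < prevPoint F x := by
  rw [nextPoint_lt_iff, lt_prevPoint_iff, min_eq_left hx, max_eq_left hy]
  simp [hx.not_gt, hy.not_gt]

lemma nextPoint_le_of_mem {F : Closeds ℝ} {x y : ℝ} (hy : y ∈ F) (hxy : x < y) :
    nextPoint F x ≤ y := by
  rcases le_or_gt 1 y with h | h
  · exact (nextPoint_le_one F x).trans h
  · exact csInf_le (bddBelow_nextPoint F x) (Or.inr ⟨hy, hxy, h⟩)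

lemma le_prevPoint_of_mem {F : Closeds ℝ} {x y : ℝ} (hy : y ∈ F) (hxy : y < x) :
    y ≤ prevPoint F x := by
  rcases le_or_gt y 0 with h | h
  · exact h.trans (prevPoint_nonneg F x)
  · exact le_csSup (bddAbove_prevPoint F x) (Or.inr ⟨hy, h, hxy⟩)

lemma nextPoint_mem {F : Closeds ℝ} (h1 : (1 : ℝ) ∈ F) (x : ℝ) : nextPoint F x ∈ F := by
  have hsub : insert 1 ((F : Set ℝ) ∩ Set.Ioo x 1) ⊆ (F : Set ℝ) := by
    rintro y (rfl | hy)
    · exact h1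
    · exact hy.1
  exact closure_minimal hsub F.isClosed
    (csInf_mem_closure (by simp) (bddBelow_nextPoint F x))

lemma prevPoint_mem {F : Closeds ℝ} (h0 : (0 : ℝ) ∈ F) (x : ℝ) : prevPoint F x ∈ F := by
  have hsub : insert 0 ((F : Set ℝ) ∩ Set.Ioo 0 x) ⊆ (F : Set ℝ) := by
    rintro y (rfl | hy)
    · exact h0
    · exact hy.1
  exact closure_minimal hsub F.isClosed
    (csSup_mem_closure (by simp) (bddAbove_prevPoint F x))

lemma firstPointAfter_eq_nextPoint {F : Closeds ℝ} (h1 : (1 : ℝ) ∈ F) {z : ℝ} (hz : z < 1) :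
    firstPointAfter F z = nextPoint F z := by
  rw [firstPointAfter, nextPoint]
  congr 1
  ext y
  simp only [Set.mem_inter_iff, Set.mem_Ioc, Set.mem_insert_iff, Set.mem_Ioo]
  constructor
  · rintro ⟨hy, hzy, hy1⟩
    rcases hy1.eq_or_lt with h | h
    · exact Or.inl h
    · exact Or.inr ⟨hy, hzy, h⟩
  · rintro (rfl | ⟨hy, hzy, hy1⟩)
    · exact ⟨h1, hz, le_rfl⟩
    · exact ⟨hy, hzy, hy1.le⟩

/-! ### Measurability -/

lemma measurableSet_hits (G : Set ℝ) (hG : IsOpen G) :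
    MeasurableSet {F : Closeds ℝ | ((F : Set ℝ) ∩ G).Nonempty} :=
  MeasurableSpace.measurableSet_generateFrom ⟨G, hG, rfl⟩

/-- A point of `F` in an open interval lies in a smaller one with rational end points, which gives
joint measurability in the interval and the set. -/
lemma measurableSet_hits_Ioo :
    MeasurableSet {p : ℝ × ℝ × Closeds ℝ | ((p.2.2 : Set ℝ) ∩ Set.Ioo p.1 p.2.1).Nonempty} := by
  have : {p : ℝ × ℝ × Closeds ℝ | ((p.2.2 : Set ℝ) ∩ Set.Ioo p.1 p.2.1).Nonempty} =
      ⋃ a : ℚ, ⋃ b : ℚ, {p : ℝ × ℝ × Closeds ℝ | p.1 < a ∧ b < p.2.1 ∧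
        ((p.2.2 : Set ℝ) ∩ Set.Ioo (a : ℝ) b).Nonempty} := by
    ext ⟨z, w, F⟩
    simp only [Set.mem_ofPred_eq, Set.mem_iUnion]
    constructor
    · rintro ⟨y, hy, h1, h2⟩
      obtain ⟨a, ha1, ha2⟩ := exists_rat_btwn h1
      obtain ⟨b, hb1, hb2⟩ := exists_rat_btwn h2
      exact ⟨a, b, ha1, hb2, y, hy, ha2, hb1⟩
    · rintro ⟨a, b, h1, h2, y, hy, h3, h4⟩
      exact ⟨y, hy, h1.trans h3, h4.trans h2⟩
  rw [this]
  refine MeasurableSet.iUnion fun a => MeasurableSet.iUnion fun b => ?_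
  refine (measurableSet_lt measurable_fst measurable_const).inter
    ((measurableSet_lt measurable_const measurable_snd.fst).inter ?_)
  exact measurable_snd.snd (measurableSet_hits (Set.Ioo (a : ℝ) b) isOpen_Ioo)

lemma measurable_nextPoint : Measurable fun p : ℝ × Closeds ℝ => nextPoint p.2 p.1 := by
  refine measurable_of_Iio fun w => ?_
  have : (fun p : ℝ × Closeds ℝ => nextPoint p.2 p.1) ⁻¹' Set.Iio w =
      {p | 1 < w} ∪ (fun p : ℝ × Closeds ℝ => (p.1, min w 1, p.2)) ⁻¹'
        {p : ℝ × ℝ × Closeds ℝ | ((p.2.2 : Set ℝ) ∩ Set.Ioo p.1 p.2.1).Nonempty} := by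
    ext p
    simp [nextPoint_lt_iff]
  rw [this]
  exact (MeasurableSet.const _).union ((by fun_prop : Measurable fun p : ℝ × Closeds ℝ =>
    (p.1, min w 1, p.2)) measurableSet_hits_Ioo)

lemma measurable_prevPoint : Measurable fun p : ℝ × Closeds ℝ => prevPoint p.2 p.1 := by
  refine measurable_of_Ioi fun w => ?_
  have : (fun p : ℝ × Closeds ℝ => prevPoint p.2 p.1) ⁻¹' Set.Ioi w =
      {p | w < 0} ∪ (fun p : ℝ × Closeds ℝ => (max w 0, p.1, p.2)) ⁻¹'
        {p : ℝ × ℝ × Closeds ℝ | ((p.2.2 : Set ℝ) ∩ Set.Ioo p.1 p.2.1).Nonempty} := by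
    ext p
    simp [lt_prevPoint_iff]
  rw [this]
  exact (MeasurableSet.const _).union ((by fun_prop : Measurable fun p : ℝ × Closeds ℝ =>
    (max w 0, p.1, p.2)) measurableSet_hits_Ioo)

/-! ### Rescaling -/

/-- A closed set with `{0, 1} ⊆ F ⊆ [0,1]`. -/
structure IsUnitClosed (F : Closeds ℝ) : Prop where
  subset_unit : (F : Set ℝ) ⊆ Set.Icc 0 1
  zero_mem : (0 : ℝ) ∈ F
  one_mem : (1 : ℝ) ∈ F

lemma IsRandomClosedSubset.isUnitClosed {Ω : Type*} [MeasurableSpace Ω] {R : Ω → Closeds ℝ}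
    (h : IsRandomClosedSubset R) (ω : Ω) : IsUnitClosed (R ω) :=
  ⟨h.subset_unit ω, h.zero_mem ω, h.one_mem ω⟩

lemma rescaledPartAfter_hits_iff {F : Closeds ℝ} (hF : IsUnitClosed F) {z p q : ℝ}
    (hd : firstPointAfter F z < 1) (hp : 0 ≤ p) :
    ((rescaledPartAfter F z : Set ℝ) ∩ Set.Ioo p q).Nonempty ↔
      ((F : Set ℝ) ∩ Set.Ioo (firstPointAfter F z + (1 - firstPointAfter F z) * p)
        (firstPointAfter F z + (1 - firstPointAfter F z) * q)).Nonempty := by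
  set d := firstPointAfter F z with hdd
  have hr : 0 < 1 - d := by linarith
  have hset : (rescaledPartAfter F z : Set ℝ) =
    (fun y : ℝ => (y - d) / (1 - d)) '' ((F : Set ℝ) ∩ Set.Icc d 1) := rfl
  rw [hset]
  constructor
  · rintro ⟨_, ⟨y, ⟨hy, -⟩, rfl⟩, h1, h2⟩
    refine ⟨y, hy, ?_, ?_⟩
    · rw [lt_div_iff₀ hr] at h1; linarith
    · rw [div_lt_iff₀ hr] at h2; linarith
  · rintro ⟨y, hy, h1, h2⟩
    refine ⟨_, ⟨y, ⟨hy, ?_, (hF.subset_unit hy).2⟩, rfl⟩, ?_, ?_⟩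
    · nlinarith [mul_nonneg hr.le hp]
    · rw [lt_div_iff₀ hr]; linarith
    · rw [div_lt_iff₀ hr]; linarith

/-- Both sides are compared with every `w`: each comparison says that an interval is hit, and
hitting is transported by the affine map. -/
lemma nextPoint_rescaledPartAfter {F : Closeds ℝ} (hF : IsUnitClosed F) {z u : ℝ}
    (hd : firstPointAfter F z < 1) (hu : 0 ≤ u) :
    nextPoint F (firstPointAfter F z + (1 - firstPointAfter F z) * u) =
      firstPointAfter F z + (1 - firstPointAfter F z) * nextPoint (rescaledPartAfter F z) u := by
  set d := firstPointAfter F z with hdd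
  have hr : 0 < 1 - d := by linarith
  refine eq_of_forall_gt_iff fun w => ?_
  have h1 : d + (1 - d) * nextPoint (rescaledPartAfter F z) u < w ↔
      nextPoint (rescaledPartAfter F z) u < (w - d) / (1 - d) := by
    rw [lt_div_iff₀ hr]
    constructor <;> intro h <;> linarith
  have h2 : 1 < (w - d) / (1 - d) ↔ 1 < w := by
    rw [lt_div_iff₀ hr]
    constructor <;> intro h <;> linarith
  have h3 : d + (1 - d) * min ((w - d) / (1 - d)) 1 = min w 1 := by
    rw [mul_min_of_nonneg _ _ hr.le, mul_div_cancel₀ _ hr.ne', ← min_add_add_left]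
    congr 1 <;> ring
  rw [h1, nextPoint_lt_iff, nextPoint_lt_iff, h2, rescaledPartAfter_hits_iff hF hd hu, h3]

lemma prevPoint_rescaledPartAfter {F : Closeds ℝ} (hF : IsUnitClosed F) {z u : ℝ} (hz : z < 1)
    (hd : firstPointAfter F z < 1) (hu : 0 < u) :
    prevPoint F (firstPointAfter F z + (1 - firstPointAfter F z) * u) =
      firstPointAfter F z + (1 - firstPointAfter F z) * prevPoint (rescaledPartAfter F z) u := by
  have hmem : firstPointAfter F z ∈ F := by
    rw [firstPointAfter_eq_nextPoint hF.one_mem hz]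
    exact nextPoint_mem hF.one_mem z
  have hd0 : 0 ≤ firstPointAfter F z := (hF.subset_unit hmem).1
  set d := firstPointAfter F z with hdd
  have hr : 0 < 1 - d := by linarith
  refine eq_of_forall_lt_iff fun w => ?_
  have h1 : w < d + (1 - d) * prevPoint (rescaledPartAfter F z) u ↔
      (w - d) / (1 - d) < prevPoint (rescaledPartAfter F z) u := by
    rw [div_lt_iff₀ hr]
    constructor <;> intro h <;> linarith
  rw [h1]
  -- Below `d` both inequalities hold, because `d` itself belongs to `F` and lies to the left of the
  -- point considered.
  rcases lt_or_ge w d with hw | hw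
  · refine iff_of_true ?_ ?_
    · exact hw.trans_le (le_prevPoint_of_mem hmem (by nlinarith))
    · exact (div_neg_of_neg_of_pos (by linarith) hr).trans_le (prevPoint_nonneg _ _)
  · have h2 : 0 ≤ (w - d) / (1 - d) := div_nonneg (by linarith) hr.le
    have h3 : d + (1 - d) * ((w - d) / (1 - d)) = w := by
      rw [mul_div_cancel₀ _ hr.ne']; ring
    rw [lt_prevPoint_iff, lt_prevPoint_iff, max_eq_left h2, max_eq_left (hd0.trans hw),
      rescaledPartAfter_hits_iff hF hd h2, h3]
    simp [h2.not_gt, (hd0.trans hw).not_gt, ← hdd]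

/-! ### Gaps -/

section Gaps

variable {F : Closeds ℝ} (hF : IsUnitClosed F)

include hF

lemma nextPoint_eq_of_mem_gap {I : ℝ × ℝ} (hI : I ∈ gaps F) {x : ℝ} (hx : x ∈ Set.Ioo I.1 I.2) :
    nextPoint F x = I.2 := by
  obtain ⟨hlt, ha, hb, hdis⟩ := hI
  refine le_antisymm (nextPoint_le_of_mem hb hx.2) ?_
  by_contra h
  rw [not_le] at h
  exact Set.disjoint_left.1 hdis
    ⟨hx.1.trans_le (le_nextPoint F (hx.2.le.trans (hF.subset_unit hb).2)), h⟩
    (nextPoint_mem hF.one_mem x)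

lemma prevPoint_eq_of_mem_gap {I : ℝ × ℝ} (hI : I ∈ gaps F) {x : ℝ} (hx : x ∈ Set.Ioo I.1 I.2) :
    prevPoint F x = I.1 := by
  obtain ⟨hlt, ha, hb, hdis⟩ := hI
  refine le_antisymm ?_ (le_prevPoint_of_mem ha hx.1)
  by_contra h
  rw [not_le] at h
  exact Set.disjoint_left.1 hdis
    ⟨h, (prevPoint_le F ((hF.subset_unit ha).1.trans hx.1.le)).trans_lt hx.2⟩
    (prevPoint_mem hF.zero_mem x)

lemma mem_gaps_of_notMem {x : ℝ} (hx : x ∈ Set.Icc (0 : ℝ) 1) (hxF : x ∉ F) :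
    (prevPoint F x, nextPoint F x) ∈ gaps F ∧ x ∈ Set.Ioo (prevPoint F x) (nextPoint F x) := by
  have h1 : x < nextPoint F x := lt_of_le_of_ne (le_nextPoint F hx.2) fun h =>
    hxF (h ▸ nextPoint_mem hF.one_mem x)
  have h2 : prevPoint F x < x := lt_of_le_of_ne (prevPoint_le F hx.1) fun h =>
    hxF (h ▸ prevPoint_mem hF.zero_mem x)
  refine ⟨⟨h2.trans h1, prevPoint_mem hF.zero_mem x, nextPoint_mem hF.one_mem x, ?_⟩, h2, h1⟩
  rw [Set.disjoint_left]
  rintro y ⟨hy1, hy2⟩ hy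
  rcases lt_trichotomy y x with h | rfl | h
  · exact hy1.not_ge (le_prevPoint_of_mem hy h)
  · exact hxF hy
  · exact hy2.not_ge (nextPoint_le_of_mem hy h)

lemma mem_gaps_nextPoint {x : ℝ} (hxF : x ∈ F) (h : x < nextPoint F x) :
    (x, nextPoint F x) ∈ gaps F := by
  refine ⟨h, hxF, nextPoint_mem hF.one_mem x, ?_⟩
  rw [Set.disjoint_left]
  rintro y ⟨hy1, hy2⟩ hy
  exact hy2.not_ge (nextPoint_le_of_mem hy hy1)

lemma mem_gaps_prevPoint {x : ℝ} (hxF : x ∈ F) (h : prevPoint F x < x) :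
    (prevPoint F x, x) ∈ gaps F := by
  refine ⟨h, prevPoint_mem hF.zero_mem x, hxF, ?_⟩
  rw [Set.disjoint_left]
  rintro y ⟨hy1, hy2⟩ hy
  exact hy1.not_ge (le_prevPoint_of_mem hy hy2)

lemma pairwiseDisjoint_gaps : (gaps F).PairwiseDisjoint fun I => Set.Ioo I.1 I.2 := by
  intro I hI J hJ hne
  refine Set.disjoint_left.2 fun x hxI hxJ => hne ?_
  rw [Prod.ext_iff]
  exact ⟨(prevPoint_eq_of_mem_gap hF hI hxI).symm.trans (prevPoint_eq_of_mem_gap hF hJ hxJ),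
    (nextPoint_eq_of_mem_gap hF hI hxI).symm.trans (nextPoint_eq_of_mem_gap hF hJ hxJ)⟩

lemma countable_gaps : (gaps F).Countable :=
  (pairwiseDisjoint_gaps hF).countable_of_isOpen (fun _ _ => isOpen_Ioo)
    fun _ hI => Set.nonempty_Ioo.2 hI.1

lemma gap_subset_unit {I : ℝ × ℝ} (hI : I ∈ gaps F) : 0 ≤ I.1 ∧ I.2 ≤ 1 :=
  ⟨(hF.subset_unit hI.2.1).1, (hF.subset_unit hI.2.2.1).2⟩

lemma unit_diff_eq_iUnion_gaps :
    Set.Ioc 0 1 \ (F : Set ℝ) = ⋃ I : gaps F, Set.Ioo I.1.1 I.1.2 := by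
  ext x
  simp only [Set.mem_sdiff, Set.mem_iUnion]
  constructor
  · rintro ⟨hx, hxF⟩
    obtain ⟨h1, h2⟩ := mem_gaps_of_notMem hF ⟨hx.1.le, hx.2⟩ hxF
    exact ⟨⟨_, h1⟩, h2⟩
  · rintro ⟨⟨I, hI⟩, hx⟩
    have := gap_subset_unit hF hI
    exact ⟨⟨this.1.trans_lt hx.1, hx.2.le.trans this.2⟩, fun h =>
      Set.disjoint_left.1 hI.2.2.2 hx h⟩

/-- An integral over the unit interval is the sum of the integrals over `F` and over the gaps. -/
lemma lintegral_unit_eq (f : ℝ → ℝ≥0∞) :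
    ∫⁻ x in Set.Ioc 0 1, f x = (∫⁻ x in Set.Ioc 0 1 ∩ (F : Set ℝ), f x) +
      ∑' I : gaps F, ∫⁻ x in Set.Ioo I.1.1 I.1.2, f x := by
  have : Countable (gaps F) := (countable_gaps hF).to_subtype
  rw [← lintegral_inter_add_sdiff f (Set.Ioc 0 1) F.isClosed.measurableSet,
    unit_diff_eq_iUnion_gaps hF, lintegral_iUnion (fun _ => measurableSet_Ioo)]
  exact (pairwiseDisjoint_gaps hF).subtype _ _

/-- The exceptional points are end points of gaps, of which there are only countably many. -/
lemma ae_mem_eq : ∀ᵐ x, x ∈ F → nextPoint F x = x ∧ prevPoint F x = x := by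
  have hc : (Prod.fst '' gaps F ∪ Prod.snd '' gaps F).Countable :=
    ((countable_gaps hF).image _).union ((countable_gaps hF).image _)
  filter_upwards [hc.ae_notMem volume] with x hx hxF
  have hu := hF.subset_unit hxF
  refine ⟨(le_nextPoint F hu.2).antisymm' ?_, (prevPoint_le F hu.1).antisymm ?_⟩
  · by_contra h
    exact hx (Or.inl ⟨_, mem_gaps_nextPoint hF hxF (not_le.1 h), rfl⟩)
  · by_contra h
    exact hx (Or.inr ⟨_, mem_gaps_prevPoint hF hxF (not_le.1 h), rfl⟩)

end Gaps

lemma Measurable.nextPoint {α : Type*} [MeasurableSpace α] {f : α → Closeds ℝ} {g : α → ℝ}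
    (hf : Measurable f) (hg : Measurable g) : Measurable fun a => _root_.nextPoint (f a) (g a) := by
  have h : (fun a => _root_.nextPoint (f a) (g a)) =
    (fun p : ℝ × Closeds ℝ => _root_.nextPoint p.2 p.1) ∘ fun a => (g a, f a) := rfl
  rw [h]
  exact measurable_nextPoint.comp (hg.prodMk hf)

lemma Measurable.prevPoint {α : Type*} [MeasurableSpace α] {f : α → Closeds ℝ} {g : α → ℝ}
    (hf : Measurable f) (hg : Measurable g) : Measurable fun a => _root_.prevPoint (f a) (g a) := by
  have h : (fun a => _root_.prevPoint (f a) (g a)) =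
    (fun p : ℝ × Closeds ℝ => _root_.prevPoint p.2 p.1) ∘ fun a => (g a, f a) := rfl
  rw [h]
  exact measurable_prevPoint.comp (hg.prodMk hf)

/-! ### Moments of gaps -/

/-- The uniform distribution on the unit interval. -/
noncomputable abbrev unitVolume : Measure ℝ := volume.restrict (Set.Ioc 0 1)

instance : IsProbabilityMeasure unitVolume := ⟨by simp⟩

/-- `(b - a) ^ i * (1 - b) ^ k`, where `]a, b[` is the gap of `F` that contains `x`. -/
noncomputable def gapWeight (i k : ℕ) (F : Closeds ℝ) (x : ℝ) : ℝ :=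
  (nextPoint F x - prevPoint F x) ^ i * (1 - nextPoint F x) ^ k

/-- The integral of `gapWeight` over the unit interval. -/
noncomputable def gapMoment (i k : ℕ) (F : Closeds ℝ) : ℝ := ∫ x, gapWeight i k F x ∂unitVolume

lemma Measurable.gapWeight {α : Type*} [MeasurableSpace α] {f : α → Closeds ℝ} {g : α → ℝ}
    (hf : Measurable f) (hg : Measurable g) (i k : ℕ) :
    Measurable fun a => _root_.gapWeight i k (f a) (g a) :=
  (((hf.nextPoint hg).sub (hf.prevPoint hg)).pow_const i).mul
    ((measurable_const.sub (hf.nextPoint hg)).pow_const k)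

lemma measurable_gapWeight_left (i k : ℕ) (F : Closeds ℝ) : Measurable (gapWeight i k F) :=
  measurable_const.gapWeight measurable_id i k

lemma measurable_gapMoment (i k : ℕ) : Measurable (gapMoment i k) := by
  have : StronglyMeasurable (Function.uncurry fun (F : Closeds ℝ) (x : ℝ) => gapWeight i k F x) :=
    (measurable_fst.gapWeight measurable_snd i k).stronglyMeasurable
  exact this.integral_prod_right.measurable

lemma nextPoint_sub_prevPoint_mem (F : Closeds ℝ) {x : ℝ} (hx : x ∈ Set.Ioc (0 : ℝ) 1) :
    nextPoint F x - prevPoint F x ∈ Set.Icc (0 : ℝ) 1 := by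
  have h1 := nextPoint_le_one F x
  have h2 := prevPoint_nonneg F x
  have h3 := le_nextPoint F hx.2
  have h4 := prevPoint_le F hx.1.le
  constructor <;> linarith

lemma one_sub_nextPoint_mem (F : Closeds ℝ) {x : ℝ} (hx : x ∈ Set.Ioc (0 : ℝ) 1) :
    1 - nextPoint F x ∈ Set.Icc (0 : ℝ) 1 := by
  have h1 := nextPoint_le_one F x
  have h3 := le_nextPoint F hx.2
  have := hx.1
  constructor <;> linarith

lemma gapWeight_mem (i k : ℕ) (F : Closeds ℝ) {x : ℝ} (hx : x ∈ Set.Ioc (0 : ℝ) 1) :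
    gapWeight i k F x ∈ Set.Icc (0 : ℝ) 1 := by
  have h1 := nextPoint_sub_prevPoint_mem F hx
  have h2 := one_sub_nextPoint_mem F hx
  exact ⟨mul_nonneg (pow_nonneg h1.1 i) (pow_nonneg h2.1 k),
    mul_le_one₀ (pow_le_one₀ h1.1 h1.2) (pow_nonneg h2.1 k) (pow_le_one₀ h2.1 h2.2)⟩

lemma ae_unitVolume_mem : ∀ᵐ x ∂unitVolume, x ∈ Set.Ioc (0 : ℝ) 1 :=
  ae_restrict_mem measurableSet_Ioc

lemma integrable_gapWeight (i k : ℕ) (F : Closeds ℝ) : Integrable (gapWeight i k F) unitVolume := by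
  refine Integrable.of_bound (C := 1) (measurable_gapWeight_left i k F).aestronglyMeasurable ?_
  filter_upwards [ae_unitVolume_mem] with x hx
  have := gapWeight_mem i k F hx
  rw [Real.norm_eq_abs, abs_le]
  exact ⟨by linarith [this.1], this.2⟩

lemma gapMoment_mem (i k : ℕ) (F : Closeds ℝ) : gapMoment i k F ∈ Set.Icc (0 : ℝ) 1 := by
  constructor
  · refine integral_nonneg_of_ae ?_
    filter_upwards [ae_unitVolume_mem] with x hx using (gapWeight_mem i k F hx).1
  · have : gapMoment i k F ≤ ∫ x, 1 ∂unitVolume := by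
      refine integral_mono_ae (integrable_gapWeight i k F) (integrable_const 1) ?_
      filter_upwards [ae_unitVolume_mem] with x hx using (gapWeight_mem i k F hx).2
    simpa using this

lemma firstPointAfter_nonneg {F : Closeds ℝ} (hF : IsUnitClosed F) {z : ℝ} (hz : z < 1) :
    0 ≤ firstPointAfter F z := by
  rw [firstPointAfter_eq_nextPoint hF.one_mem hz]
  exact (hF.subset_unit (nextPoint_mem hF.one_mem z)).1

/-- The contribution of the gaps to the right of `D(F, z)` to a moment. -/
lemma integral_indicator_gapWeight (i k : ℕ) {F : Closeds ℝ} (hF : IsUnitClosed F) {z : ℝ}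
    (hz : z < 1) (hd : firstPointAfter F z < 1) :
    ∫ x, (Set.Ioi (firstPointAfter F z)).indicator (gapWeight i k F) x ∂unitVolume =
      (1 - firstPointAfter F z) ^ (i + k + 1) * gapMoment i k (rescaledPartAfter F z) := by
  have hd0 := firstPointAfter_nonneg hF hz
  have hset : Set.Ioc (0 : ℝ) 1 ∩ Set.Ioi (firstPointAfter F z) =
      Set.Ioc (firstPointAfter F z) 1 := by
    ext x
    simp only [Set.mem_inter_iff, Set.mem_Ioc, Set.mem_Ioi]
    constructor
    · rintro ⟨h1, h2⟩; exact ⟨h2, h1.2⟩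
    · rintro ⟨h1, h2⟩; exact ⟨⟨by linarith, h2⟩, h1⟩
  rw [setIntegral_indicator (E := ℝ) measurableSet_Ioi, hset, ← intervalIntegral.integral_of_le hd.le]
  -- The substitution `x = d + (1 - d) u` scales each of the `i + k` factors by `1 - d`; its
  -- Jacobian supplies the remaining one.
  have h1 := intervalIntegral.smul_integral_comp_add_mul (a := 0) (b := 1) (gapWeight i k F)
    (1 - firstPointAfter F z) (firstPointAfter F z)
  rw [mul_zero, add_zero, mul_one, add_sub_cancel] at h1
  rw [← h1, gapMoment, ← intervalIntegral.integral_of_le zero_le_one, smul_eq_mul, pow_succ',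
    mul_assoc]
  congr 1
  rw [← intervalIntegral.integral_const_mul]
  refine intervalIntegral.integral_congr_ae (E := ℝ)
    (Filter.Eventually.of_forall fun x hx => ?_)
  rw [Set.uIoc_of_le zero_le_one] at hx
  rw [gapWeight, gapWeight, nextPoint_rescaledPartAfter hF hd hx.1.le,
    prevPoint_rescaledPartAfter hF hz hd hx.1, pow_add]
  set d := firstPointAfter F z
  set D := nextPoint (rescaledPartAfter F z) x
  set G := prevPoint (rescaledPartAfter F z) x
  rw [show d + (1 - d) * D - (d + (1 - d) * G) = (1 - d) * (D - G) by ring,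
    show 1 - (d + (1 - d) * D) = (1 - d) * (1 - D) by ring, mul_pow, mul_pow]
  ring

/-- `prevPoint F x` is the measure of the points `y` with `nextPoint F y < x`. -/
lemma integral_indicator_nextPoint (F : Closeds ℝ) {x : ℝ} (hx : x ∈ Set.Ioc (0 : ℝ) 1) :
    ∫ y, (Set.Ioi (nextPoint F y)).indicator (fun _ => (1 : ℝ)) x ∂unitVolume = prevPoint F x := by
  have h1 : ∫ y, (Set.Ioi (nextPoint F y)).indicator (fun _ => (1 : ℝ)) x ∂unitVolume =
      ∫ y, (Set.Iio (prevPoint F x)).indicator (fun _ => (1 : ℝ)) y ∂unitVolume := by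
    refine integral_congr_ae ?_
    filter_upwards [ae_unitVolume_mem] with y hy
    simp only [Set.indicator_apply, Set.mem_Ioi, Set.mem_Iio,
      nextPoint_lt_iff_lt_prevPoint F hy.1.le hx.2]
  have hset : Set.Ioc (0 : ℝ) 1 ∩ Set.Iio (prevPoint F x) = Set.Ioo 0 (prevPoint F x) := by
    ext y
    have := (prevPoint_le F hx.1.le).trans hx.2
    simp only [Set.mem_inter_iff, Set.mem_Ioc, Set.mem_Iio, Set.mem_Ioo]
    constructor
    · rintro ⟨h1, h2⟩; exact ⟨h1.1, h2⟩
    · rintro ⟨h1, h2⟩; exact ⟨⟨h1, by linarith⟩, h2⟩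
  rw [h1, setIntegral_indicator measurableSet_Iio, hset]
  simp [prevPoint_nonneg]

/-- The weight is multiplied by `1 = (b - a) + (1 - b) + a`. The factor `a` is the probability that
a uniform point `y` satisfies `nextPoint F y < x`, which prepares for regeneration at `y`. -/
lemma gapMoment_eq_add (i k : ℕ) (F : Closeds ℝ) :
    gapMoment i k F = gapMoment (i + 1) k F + gapMoment i (k + 1) F +
      ∫ x, ∫ y, (Set.Ioi (nextPoint F y)).indicator (gapWeight i k F) x ∂unitVolume ∂unitVolume := by
  have h1 : ∫ x, ∫ y, (Set.Ioi (nextPoint F y)).indicator (gapWeight i k F) x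
      ∂unitVolume ∂unitVolume = ∫ x, (gapWeight i k F x - gapWeight (i + 1) k F x -
        gapWeight i (k + 1) F x) ∂unitVolume := by
    refine integral_congr_ae ?_
    filter_upwards [ae_unitVolume_mem] with x hx
    have h2 : ∀ y, (Set.Ioi (nextPoint F y)).indicator (gapWeight i k F) x =
        gapWeight i k F x * (Set.Ioi (nextPoint F y)).indicator (fun _ => (1 : ℝ)) x := by
      intro y
      simp [Set.indicator_apply]
    simp only [h2]
    rw [integral_const_mul, integral_indicator_nextPoint F hx]
    simp only [gapWeight]
    ring
  have h2 : ∫ x, (gapWeight i k F x - gapWeight (i + 1) k F x - gapWeight i (k + 1) F x)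
      ∂unitVolume = ∫ x, (gapWeight i k F x - gapWeight (i + 1) k F x) ∂unitVolume -
        ∫ x, gapWeight i (k + 1) F x ∂unitVolume :=
    integral_sub ((integrable_gapWeight _ _ _).sub (integrable_gapWeight _ _ _))
      (integrable_gapWeight _ _ _)
  rw [h1, h2, integral_sub (integrable_gapWeight _ _ _) (integrable_gapWeight _ _ _)]
  simp only [gapMoment]
  ring

/-! ### The sum rule -/

lemma sum_Icc_one_succ (f : ℕ → ℝ) (n : ℕ) :
    ∑ m ∈ Finset.Icc 1 (n + 1), f m = f 1 + ∑ j ∈ Finset.range n, f (j + 2) := by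
  induction n with
  | zero => simp
  | succ n ih => rw [Finset.sum_Icc_succ_top (by omega), ih, Finset.sum_range_succ]; ring

/-- Multiplied by `t`, both sides are `(b + t)^(n+1) - b^(n+1)`. The case `t = 0`, treated
separately, is the one that occurs almost everywhere on `F`. -/
lemma geom_sum₂_eq_binomial_sum (t b : ℝ) (n : ℕ) :
    ∑ i ∈ Finset.range (n + 1), (b + t) ^ i * b ^ (n - i) = (n + 1) * b ^ n +
      ∑ j ∈ Finset.range n, (n + 1).choose (j + 2) * (t ^ (j + 1) * b ^ (n + 1 - (j + 2))) := by
  rcases eq_or_ne t 0 with rfl | ht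
  · rw [Finset.sum_congr rfl (g := fun _ => b ^ n)]
    · simp
    · intro i hi
      rw [add_zero, ← pow_add]
      congr 1
      have := Finset.mem_range.1 hi
      omega
  · refine mul_right_cancel₀ ht ?_
    have h1 := geom_sum₂_mul (b + t) b (n + 1)
    rw [add_sub_cancel_left, Nat.add_sub_cancel] at h1
    rw [h1, add_comm b t, add_pow, Finset.sum_range_succ', Finset.sum_range_succ', add_mul,
      Finset.sum_mul]
    have h2 : ∀ j, t ^ (j + 1 + 1) * b ^ (n + 1 - (j + 1 + 1)) * (n + 1).choose (j + 1 + 1) =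
        (n + 1).choose (j + 2) * (t ^ (j + 1) * b ^ (n + 1 - (j + 2))) * t := by
      intro j
      rw [pow_succ t (j + 1)]
      ring
    simp only [h2]
    simp
    ring

lemma lintegral_gap_const {I : ℝ × ℝ} (c : ℝ≥0∞) :
    ∫⁻ _ in Set.Ioo I.1 I.2, c = c * ENNReal.ofReal (I.2 - I.1) := by
  rw [setLIntegral_const, Real.volume_Ioo]

/-- The integrand is compared with `(n + 1) (1 - x)^n`, of integral `1`: the two agree almost
everywhere on `F`, and over a gap `]a, b[` both integrate to `(1 - a)^(n+1) - (1 - b)^(n+1)`. -/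
lemma lintegral_geom_sum {F : Closeds ℝ} (hF : IsUnitClosed F) (n : ℕ) :
    ∫⁻ x, ENNReal.ofReal (∑ i ∈ Finset.range (n + 1),
      (1 - prevPoint F x) ^ i * (1 - nextPoint F x) ^ (n - i)) ∂unitVolume = 1 := by
  have h1 : ∫⁻ x, ENNReal.ofReal ((n + 1) * (1 - x) ^ n) ∂unitVolume = 1 := by
    rw [← ofReal_integral_eq_lintegral_ofReal]
    · rw [← intervalIntegral.integral_of_le zero_le_one, intervalIntegral.integral_const_mul,
        intervalIntegral.integral_comp_sub_left (fun x => x ^ n) 1]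
      simp
      field_simp
    · exact (Continuous.integrableOn_Ioc (by fun_prop))
    · filter_upwards [ae_unitVolume_mem] with x hx
      have : 0 ≤ 1 - x := by linarith [hx.2]
      simp only [Pi.zero_apply]
      positivity
  rw [← h1, lintegral_unit_eq hF, lintegral_unit_eq hF]
  congr 1
  · refine lintegral_congr_ae ?_
    filter_upwards [ae_restrict_mem (measurableSet_Ioc.inter F.isClosed.measurableSet),
      ae_restrict_of_ae (ae_mem_eq hF)] with x hx hx2
    obtain ⟨e1, e2⟩ := hx2 hx.2
    rw [e1, e2, Finset.sum_congr rfl (g := fun _ => (1 - x) ^ n)]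
    · simp
    · intro i hi
      rw [← pow_add]
      congr 1
      have := Finset.mem_range.1 hi
      omega
  · refine tsum_congr fun I => ?_
    obtain ⟨h0, h1⟩ := gap_subset_unit hF I.2
    have hlt := I.2.1
    calc _ = ∫⁻ x in Set.Ioo I.1.1 I.1.2, ENNReal.ofReal (∑ i ∈ Finset.range (n + 1),
          (1 - I.1.1) ^ i * (1 - I.1.2) ^ (n - i)) := by
          refine setLIntegral_congr_fun measurableSet_Ioo fun x hx => ?_
          simp only [nextPoint_eq_of_mem_gap hF I.2 hx, prevPoint_eq_of_mem_gap hF I.2 hx]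
      _ = ENNReal.ofReal ((1 - I.1.1) ^ (n + 1) - (1 - I.1.2) ^ (n + 1)) := by
          rw [lintegral_gap_const, ← ENNReal.ofReal_mul, ← geom_sum₂_mul]
          · congr 2
            ring
          · exact Finset.sum_nonneg fun i _ => mul_nonneg (pow_nonneg (by linarith) _)
              (pow_nonneg (by linarith) _)
      _ = _ := by
          rw [setLIntegral_congr Ioo_ae_eq_Ioc, ← ofReal_integral_eq_lintegral_ofReal]
          · rw [← intervalIntegral.integral_of_le hlt.le, intervalIntegral.integral_const_mul,
              intervalIntegral.integral_comp_sub_left (fun x => x ^ n) 1]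
            congr 1
            rw [integral_pow]
            field_simp
          · exact (Continuous.integrableOn_Ioc (by fun_prop))
          · filter_upwards [ae_restrict_mem measurableSet_Ioc] with x hx
            have : 0 ≤ 1 - x := by linarith [hx.2]
            simp only [Pi.zero_apply]
            positivity

/-- Expanding the geometric sum in powers of the gap length turns `lintegral_geom_sum` into the row
sum of the future decrement matrix. -/
lemma gapMoment_sum {F : Closeds ℝ} (hF : IsUnitClosed F) (n : ℕ) :
    (n + 1) * gapMoment 0 n F + ∑ j ∈ Finset.range n,
      (n + 1).choose (j + 2) * gapMoment (j + 1) (n + 1 - (j + 2)) F = 1 := by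
  have hm : Measurable (nextPoint F) := measurable_const.nextPoint measurable_id
  have hm' : Measurable (prevPoint F) := measurable_const.prevPoint measurable_id
  have h1 : ∫ x, ∑ i ∈ Finset.range (n + 1),
      (1 - prevPoint F x) ^ i * (1 - nextPoint F x) ^ (n - i) ∂unitVolume = 1 := by
    rw [integral_eq_lintegral_of_nonneg_ae, lintegral_geom_sum hF, ENNReal.toReal_one]
    · filter_upwards [ae_unitVolume_mem] with x hx
      have h1 := nextPoint_le_one F x
      have h2 := (prevPoint_le F hx.1.le).trans hx.2
      exact Finset.sum_nonneg fun i _ => mul_nonneg (pow_nonneg (by linarith) _)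
        (pow_nonneg (by linarith) _)
    · exact (Measurable.aestronglyMeasurable (by fun_prop))
  refine Eq.trans ?_ h1
  have h2 : ∀ x, ∑ i ∈ Finset.range (n + 1),
      (1 - prevPoint F x) ^ i * (1 - nextPoint F x) ^ (n - i) = (n + 1) * gapWeight 0 n F x +
      ∑ j ∈ Finset.range n, (n + 1).choose (j + 2) * gapWeight (j + 1) (n + 1 - (j + 2)) F x := by
    intro x
    have := geom_sum₂_eq_binomial_sum (nextPoint F x - prevPoint F x) (1 - nextPoint F x) n
    rw [show 1 - nextPoint F x + (nextPoint F x - prevPoint F x) = 1 - prevPoint F x by ring] at this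
    rw [this]
    simp [gapWeight]
  simp only [h2]
  rw [integral_add ((integrable_gapWeight _ _ _).const_mul _)
    (integrable_finsetSum _ fun j _ => (integrable_gapWeight _ _ _).const_mul _),
    integral_finsetSum _ fun j _ => (integrable_gapWeight _ _ _).const_mul _]
  simp only [integral_const_mul, gapMoment]

/-! ### Ranked lengths -/

/-- A uniform point finds a gap with probability equal to its length, which adds one to the
exponent. Almost every point of `F` has weight `0`, the exponent being positive. -/
lemma lintegral_gapWeight_zero {F : Closeds ℝ} (hF : IsUnitClosed F) (n : ℕ) :
    ∫⁻ x, ENNReal.ofReal (gapWeight (n + 1) 0 F x) ∂unitVolume =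
      ∑' I : gaps F, ENNReal.ofReal ((I.1.2 - I.1.1) ^ (n + 2)) := by
  rw [lintegral_unit_eq hF]
  have h0 : ∫⁻ x in Set.Ioc 0 1 ∩ (F : Set ℝ), ENNReal.ofReal (gapWeight (n + 1) 0 F x) = 0 := by
    rw [← lintegral_zero (μ := volume.restrict (Set.Ioc 0 1 ∩ (F : Set ℝ)))]
    refine lintegral_congr_ae ?_
    filter_upwards [ae_restrict_mem (measurableSet_Ioc.inter F.isClosed.measurableSet),
      ae_restrict_of_ae (ae_mem_eq hF)] with x hx hx2
    obtain ⟨e1, e2⟩ := hx2 hx.2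
    simp [gapWeight, e1, e2]
  rw [h0, zero_add]
  refine tsum_congr fun I => ?_
  have hlt := I.2.1
  calc _ = ∫⁻ x in Set.Ioo I.1.1 I.1.2, ENNReal.ofReal ((I.1.2 - I.1.1) ^ (n + 1)) := by
        refine setLIntegral_congr_fun measurableSet_Ioo fun x hx => ?_
        simp [gapWeight, nextPoint_eq_of_mem_gap hF I.2 hx, prevPoint_eq_of_mem_gap hF I.2 hx]
    _ = _ := by
        rw [lintegral_gap_const, ← ENNReal.ofReal_mul (pow_nonneg (by linarith) _), ← pow_succ]

lemma lt_rankedLengths_iff {F : Closeds ℝ} (hF : IsUnitClosed F) (j : ℕ) {t : ℝ} (ht : 0 ≤ t) :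
    t < rankedLengths F j ↔ ((j + 1 : ℕ) : ℕ∞) ≤ {I : gaps F | t < I.1.2 - I.1.1}.encard := by
  have hcard : ∀ p : ℝ → Prop, {I : gaps F | p (I.1.2 - I.1.1)}.encard =
      {I ∈ gaps F | p (I.2 - I.1)}.encard := by
    intro p
    rw [← Subtype.val_injective.encard_image]
    congr 1
    ext I
    simp [and_comm]
  rw [hcard (fun x => t < x)]
  constructor
  · intro h
    have hne : {x : ℝ | 0 < x ∧ ((j + 1 : ℕ) : ℕ∞) ≤
        {I ∈ gaps F | x ≤ I.2 - I.1}.encard}.Nonempty := by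
      by_contra hemp
      rw [Set.not_nonempty_iff_eq_empty] at hemp
      rw [rankedLengths, hemp, Real.sSup_empty] at h
      linarith
    obtain ⟨x, ⟨-, hx⟩, htx⟩ := exists_lt_of_lt_csSup hne h
    refine hx.trans (Set.encard_le_encard ?_)
    rintro I ⟨hI, hxI⟩
    exact ⟨hI, htx.trans_le hxI⟩
  · intro h
    obtain ⟨s, hs, hcs⟩ := Set.exists_subset_encard_eq h
    have hfin : s.Finite := Set.finite_of_encard_eq_coe hcs
    have hne : s.Nonempty := by
      rw [← Set.encard_pos, hcs]
      exact_mod_cast Nat.succ_pos j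
    -- The shortest of `j + 1` gaps longer than `t` still exceeds `t`, so its length is an
    -- admissible `x` in the supremum.
    obtain ⟨J, hJ, hmin⟩ := hfin.exists_minimalFor (fun I => I.2 - I.1) s hne
    have hlt : t < J.2 - J.1 := (hs hJ).2
    refine hlt.trans_le (le_csSup ⟨1, ?_⟩ ⟨ht.trans_lt hlt, ?_⟩)
    · rintro x ⟨-, hx⟩
      have : {I ∈ gaps F | x ≤ I.2 - I.1}.Nonempty := by
        rw [← Set.encard_pos]
        exact lt_of_lt_of_le (by exact_mod_cast Nat.succ_pos j) hx
      obtain ⟨I, hI, hxI⟩ := this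
      have := gap_subset_unit hF hI
      linarith
    · rw [← hcs]
      refine Set.encard_le_encard fun I hI => ⟨(hs hI).1, ?_⟩
      exact (le_total (J.2 - J.1) (I.2 - I.1)).elim id fun h => hmin hI h

lemma encard_setOf_succ_le (N : ℕ∞) : {j : ℕ | ((j + 1 : ℕ) : ℕ∞) ≤ N}.encard = N := by
  induction N using ENat.recTopCoe with
  | top => simp
  | coe n =>
    have : {j : ℕ | ((j + 1 : ℕ) : ℕ∞) ≤ (n : ℕ∞)} = (Finset.range n : Set ℕ) := by
      ext j
      simp only [Set.mem_ofPred_eq, Nat.cast_le, Finset.coe_range, Set.mem_Iio]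
      omega
    rw [this, Set.encard_coe_eq_coe_finsetCard, Finset.card_range]

lemma rankedLengths_nonneg (F : Closeds ℝ) (j : ℕ) : 0 ≤ rankedLengths F j :=
  Real.sSup_nonneg fun _ hx => hx.1.le

/-- A sum over the gaps is a sum over the ranked lengths. -/
lemma tsum_gaps_eq_tsum_rankedLengths {F : Closeds ℝ} (hF : IsUnitClosed F) (n : ℕ) :
    ∑' I : gaps F, ENNReal.ofReal ((I.1.2 - I.1.1) ^ (n + 1)) =
      ∑' j : ℕ, ENNReal.ofReal (rankedLengths F j ^ (n + 1)) := by
  have hcount : Countable (gaps F) := (countable_gaps hF).to_subtype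
  -- By the layer cake formula each power sum depends only on the counting function `t ↦ #{a | t < f
  -- a}`, which is the same for the gaps and for the ranked lengths.
  have key : ∀ {α : Type} [MeasurableSpace α] [DiscreteMeasurableSpace α] (f : α → ℝ),
      (∀ a, 0 ≤ f a) → ∑' a, ENNReal.ofReal (f a ^ (n + 1)) = ∫⁻ t in Set.Ioi (0 : ℝ),
        ({a | t < f a}.encard : ℝ≥0∞) * ENNReal.ofReal ((n + 1) * t ^ n) := by
    intro α _ _ f hf
    have h := lintegral_comp_eq_lintegral_meas_lt_mul (f := f) (g := fun t => (n + 1) * t ^ n)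
      Measure.count (Filter.Eventually.of_forall hf) (Measurable.of_discrete).aemeasurable
      (fun t _ => (by fun_prop : Continuous fun t : ℝ => ((n : ℝ) + 1) * t ^ n).intervalIntegrable
        0 t)
      (by
        filter_upwards [ae_restrict_mem measurableSet_Ioi] with t ht
        have : (0 : ℝ) < t := ht
        positivity)
    simp only [Measure.count_apply (MeasurableSet.of_discrete)] at h
    rw [← h, lintegral_count]
    refine tsum_congr fun a => ?_
    congr 1
    rw [intervalIntegral.integral_const_mul, integral_pow]
    field_simp
    simp
  rw [key (fun I : gaps F => I.1.2 - I.1.1) (fun I => sub_nonneg.2 I.2.1.le),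
    key (rankedLengths F) (rankedLengths_nonneg F)]
  refine setLIntegral_congr_fun measurableSet_Ioi fun t ht => ?_
  simp only [lt_rankedLengths_iff hF _ (le_of_lt (Set.mem_Ioi.1 ht)), encard_setOf_succ_le]

lemma gapMoment_zero_eq {F : Closeds ℝ} (hF : IsUnitClosed F) (n : ℕ) :
    ENNReal.ofReal (gapMoment (n + 1) 0 F) =
      ∑' j : ℕ, ENNReal.ofReal (rankedLengths F j ^ (n + 2)) := by
  rw [← tsum_gaps_eq_tsum_rankedLengths hF, ← lintegral_gapWeight_zero hF, gapMoment,
    ofReal_integral_eq_lintegral_ofReal (integrable_gapWeight _ _ _)]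
  filter_upwards [ae_unitVolume_mem] with x hx using (gapWeight_mem _ _ F hx).1

/-! ### Consequences of regeneration -/

lemma measurable_prevPoint_right (x : ℝ) : Measurable fun F : Closeds ℝ => prevPoint F x :=
  measurable_id.prevPoint measurable_const

/-- `D(F, z)` is thus recovered measurably from the part of `F` before it, so independence from that
part yields independence from `D(F, z)`. -/
lemma prevPoint_partBefore {F : Closeds ℝ} (hF : IsUnitClosed F) {z : ℝ} (hz : z < 1)
    (hd : firstPointAfter F z < 1) : prevPoint (partBefore F z) 1 = firstPointAfter F z := by
  have hd0 := firstPointAfter_nonneg hF hz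
  refine le_antisymm (csSup_le (by simp) ?_) (le_prevPoint_of_mem (F := partBefore F z) ?_ hd)
  · rintro y (rfl | hy)
    · exact hd0
    · exact hy.1.1.2
  · refine ⟨⟨hd0, le_rfl⟩, ?_⟩
    rw [firstPointAfter_eq_nextPoint hF.one_mem hz]
    exact nextPoint_mem hF.one_mem z

/-- The mean of a moment. -/
noncomputable def meanGapMoment {Ω : Type*} [MeasurableSpace Ω] (μ : Measure Ω)
    (R : Ω → Closeds ℝ) (i k : ℕ) : ℝ := ∫ ω, gapMoment i k (R ω) ∂μ

/-- The integral of `gapWeight` over the part of the unit interval to the right of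
`nextPoint F y`. -/
noncomputable def gapMomentAfter (i k : ℕ) (F : Closeds ℝ) (y : ℝ) : ℝ :=
  ∫ x, (Set.Ioi (nextPoint F y)).indicator (gapWeight i k F) x ∂unitVolume

lemma measurable_indicator_gapWeight (i k : ℕ) :
    Measurable fun p : (Closeds ℝ × ℝ) × ℝ =>
      (Set.Ioi (nextPoint p.1.1 p.1.2)).indicator (gapWeight i k p.1.1) p.2 := by
  have h1 : Measurable fun p : (Closeds ℝ × ℝ) × ℝ => gapWeight i k p.1.1 p.2 :=
    measurable_fst.fst.gapWeight measurable_snd i k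
  have h2 : Measurable fun p : (Closeds ℝ × ℝ) × ℝ => nextPoint p.1.1 p.1.2 :=
    measurable_fst.fst.nextPoint measurable_fst.snd
  have h3 : (fun p : (Closeds ℝ × ℝ) × ℝ =>
      (Set.Ioi (nextPoint p.1.1 p.1.2)).indicator (gapWeight i k p.1.1) p.2) =
      {p : (Closeds ℝ × ℝ) × ℝ | nextPoint p.1.1 p.1.2 < p.2}.indicator
        fun p => gapWeight i k p.1.1 p.2 := by
    ext p
    simp [Set.indicator_apply]
  rw [h3]
  exact h1.indicator (measurableSet_lt h2 measurable_snd)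

lemma norm_indicator_gapWeight_le (i k : ℕ) (F : Closeds ℝ) (s : Set ℝ) {x : ℝ}
    (hx : x ∈ Set.Ioc (0 : ℝ) 1) : ‖s.indicator (gapWeight i k F) x‖ ≤ 1 := by
  refine (norm_indicator_le_norm_self _ _).trans ?_
  have := gapWeight_mem i k F hx
  rw [Real.norm_eq_abs, abs_le]
  exact ⟨by linarith [this.1], this.2⟩

lemma measurable_gapMomentAfter (i k : ℕ) :
    Measurable fun p : Closeds ℝ × ℝ => gapMomentAfter i k p.1 p.2 := by
  have : StronglyMeasurable (Function.uncurry fun (p : Closeds ℝ × ℝ) (x : ℝ) =>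
      (Set.Ioi (nextPoint p.1 p.2)).indicator (gapWeight i k p.1) x) :=
    (measurable_indicator_gapWeight i k).stronglyMeasurable
  exact this.integral_prod_right.measurable

lemma norm_gapMomentAfter_le (i k : ℕ) (F : Closeds ℝ) (y : ℝ) : ‖gapMomentAfter i k F y‖ ≤ 1 := by
  have := norm_integral_le_of_norm_le_const (μ := unitVolume) (C := 1)
    (f := (Set.Ioi (nextPoint F y)).indicator (gapWeight i k F)) (by
      filter_upwards [ae_unitVolume_mem] with x hx using norm_indicator_gapWeight_le i k F _ hx)
  simpa [gapMomentAfter] using this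

lemma gapMoment_eq_add_integral (i k : ℕ) (F : Closeds ℝ) :
    gapMoment i k F = gapMoment (i + 1) k F + gapMoment i (k + 1) F +
      ∫ y, gapMomentAfter i k F y ∂unitVolume := by
  rw [gapMoment_eq_add]
  congr 1
  refine integral_integral_swap ?_
  refine Integrable.of_bound (C := 1) ?_ ?_
  · have h : Measurable fun p : ℝ × ℝ => ((F, p.2), p.1) := by fun_prop
    have h2 := (measurable_indicator_gapWeight i k).comp h
    exact h2.aestronglyMeasurable
  · filter_upwards [Measure.quasiMeasurePreserving_fst.ae ae_unitVolume_mem] with p hp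
    exact norm_indicator_gapWeight_le i k F _ hp

section Regeneration

variable {Ω : Type*} [MeasurableSpace Ω] {μ : Measure Ω} [IsProbabilityMeasure μ]
  {R : Ω → Closeds ℝ}

lemma IsRandomClosedSubset.measurable_firstPointAfter (hR : IsRandomClosedSubset R) {z : ℝ}
    (hz : z < 1) : Measurable fun ω => firstPointAfter (R ω) z := by
  have : (fun ω => firstPointAfter (R ω) z) = fun ω => nextPoint (R ω) z := by
    ext ω
    exact firstPointAfter_eq_nextPoint (hR.one_mem ω) hz
  rw [this]
  exact hR.measurable.nextPoint measurable_const

lemma IsRandomClosedSubset.integrable_gapMoment (hR : IsRandomClosedSubset R) (i k : ℕ) :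
    Integrable (fun ω => gapMoment i k (R ω)) μ := by
  refine Integrable.of_bound (C := 1)
    ((measurable_gapMoment i k).comp hR.measurable).aestronglyMeasurable
    (Filter.Eventually.of_forall fun ω => ?_)
  have := gapMoment_mem i k (R ω)
  rw [Real.norm_eq_abs, abs_le]
  exact ⟨by linarith [this.1], this.2⟩

/-- On the event that `D(R, z) < 1`, the joint law of `D(R, z)` and `R(z)` is a product. -/
lemma IsMultiplicativelyRegenerative.map_restrict (hR : IsMultiplicativelyRegenerative μ R) {z : ℝ}
    (hz : z ∈ Set.Ico (0 : ℝ) 1) :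
    AEMeasurable (fun ω => rescaledPartAfter (R ω) z)
      (μ.restrict {ω | firstPointAfter (R ω) z < 1}) ∧
    (μ.restrict {ω | firstPointAfter (R ω) z < 1}).map
      (fun ω => (firstPointAfter (R ω) z, rescaledPartAfter (R ω) z)) =
    ((μ.restrict {ω | firstPointAfter (R ω) z < 1}).map (fun ω => firstPointAfter (R ω) z)).prod
      (μ.map R) := by
  set A := {ω | firstPointAfter (R ω) z < 1} with hA
  by_cases h0 : μ A = 0
  · rw [Measure.restrict_eq_zero.2 h0]
    simp
  obtain ⟨hind, hid⟩ := hR.regenerative z hz h0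
  have hD := hR.measurable_firstPointAfter hz.2
  have hmA : MeasurableSet A := measurableSet_lt hD measurable_const
  have e : μ.restrict A = μ A • μ[|A] := by
    rw [ProbabilityTheory.cond, smul_smul, ENNReal.mul_inv_cancel h0 (measure_ne_top _ _), one_smul]
  have hpr : IsProbabilityMeasure μ[|A] := cond_isProbabilityMeasure h0
  have hae : ∀ᵐ ω ∂μ[|A], prevPoint (partBefore (R ω) z) 1 = firstPointAfter (R ω) z := by
    filter_upwards [ae_cond_mem hmA] with ω hω
    exact prevPoint_partBefore (hR.isUnitClosed ω) hz.2 hω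
  have hind2 : IndepFun (fun ω => firstPointAfter (R ω) z) (fun ω => rescaledPartAfter (R ω) z)
      μ[|A] := by
    have h1 := (hind.comp measurable_id (measurable_prevPoint_right 1)).symm
    exact h1.congr hae (Filter.EventuallyEq.refl _ _)
  have h2 := (indepFun_iff_map_prod_eq_prod_map_map hD.aemeasurable hid.aemeasurable_fst).1 hind2
  rw [e]
  -- Almost everywhere measurability of the rescaled set is part of the assumed identity in
  -- distribution.
  refine ⟨hid.aemeasurable_fst.smul_measure _, ?_⟩
  rw [Measure.map_smul, Measure.map_smul, Measure.prod_smul_left, h2, hid.map_eq]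

lemma gapMomentAfter_eq {F : Closeds ℝ} (hF : IsUnitClosed F) (i k : ℕ) {y : ℝ} (hy : y < 1) :
    gapMomentAfter i k F y = Set.indicator {F | firstPointAfter F y < 1} (fun F =>
      (1 - firstPointAfter F y) ^ (i + k + 1) * gapMoment i k (rescaledPartAfter F y)) F := by
  rw [gapMomentAfter, ← firstPointAfter_eq_nextPoint hF.one_mem hy]
  by_cases h : firstPointAfter F y < 1
  · rw [Set.indicator_of_mem (show F ∈ {F | firstPointAfter F y < 1} from h),
      integral_indicator_gapWeight i k hF hy h]
  · rw [Set.indicator_of_notMem (show F ∉ {F | firstPointAfter F y < 1} from h)]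
    refine integral_eq_zero_of_ae ?_
    filter_upwards [ae_unitVolume_mem] with x hx
    refine Set.indicator_of_notMem ?_ _
    rw [Set.mem_Ioi, not_lt]
    exact hx.2.trans (not_lt.1 h)

/-- What lies beyond `D(R, y)` is an independent copy of `R` scaled by `1 - D(R, y)`, and scaling
multiplies a moment by the power `i + k + 1` of this factor. -/
lemma IsMultiplicativelyRegenerative.integral_gapMomentAfter
    (hR : IsMultiplicativelyRegenerative μ R) (i k : ℕ) {y : ℝ} (hy : y ∈ Set.Ico (0 : ℝ) 1) :
    ∫ ω, gapMomentAfter i k (R ω) y ∂μ =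
      (∫ ω, gapWeight 0 (i + k + 1) (R ω) y ∂μ) * meanGapMoment μ R i k := by
  have hD := hR.measurable_firstPointAfter hy.2
  have hmA : MeasurableSet {ω | firstPointAfter (R ω) y < 1} := measurableSet_lt hD measurable_const
  obtain ⟨hm, hmap⟩ := hR.map_restrict hy
  have h1 : ∫ ω, gapMomentAfter i k (R ω) y ∂μ = ∫ ω in {ω | firstPointAfter (R ω) y < 1},
      (1 - firstPointAfter (R ω) y) ^ (i + k + 1) *
        gapMoment i k (rescaledPartAfter (R ω) y) ∂μ := by
    rw [← integral_indicator hmA]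
    refine integral_congr_ae (Filter.Eventually.of_forall fun ω => ?_)
    simp only [gapMomentAfter_eq (hR.isUnitClosed ω) i k hy.2]
    simp [Set.indicator_apply]
  have h2 : ∫ ω, gapWeight 0 (i + k + 1) (R ω) y ∂μ =
      ∫ ω in {ω | firstPointAfter (R ω) y < 1}, (1 - firstPointAfter (R ω) y) ^ (i + k + 1) ∂μ := by
    rw [← integral_indicator hmA]
    refine integral_congr_ae (Filter.Eventually.of_forall fun ω => ?_)
    simp only [gapWeight, pow_zero, one_mul, Set.indicator_apply, Set.mem_ofPred_eq,
      ← firstPointAfter_eq_nextPoint (hR.one_mem ω) hy.2]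
    -- If the event fails then `D = 1`, and the positive power of `1 - D` vanishes.
    split_ifs with h
    · rfl
    · have h3 : firstPointAfter (R ω) y = 1 := by
        refine le_antisymm ?_ (not_lt.1 h)
        rw [firstPointAfter_eq_nextPoint (hR.one_mem ω) hy.2]
        exact nextPoint_le_one _ _
      simp [h3]
  have h3 := integral_map (μ := μ.restrict {ω | firstPointAfter (R ω) y < 1})
    (hD.aemeasurable.prodMk hm)
    (f := fun p : ℝ × Closeds ℝ => (1 - p.1) ^ (i + k + 1) * gapMoment i k p.2)
    (by
      have : Measurable fun p : ℝ × Closeds ℝ => gapMoment i k p.2 :=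
        (measurable_gapMoment i k).comp measurable_snd
      exact Measurable.aestronglyMeasurable (Measurable.mul (by fun_prop) this))
  rw [h1, h2, ← h3, hmap, integral_prod_mul (fun d : ℝ => (1 - d) ^ (i + k + 1)) (gapMoment i k),
    integral_map hD.aemeasurable (by fun_prop), integral_map hR.measurable.aemeasurable
      (measurable_gapMoment i k).aestronglyMeasurable]
  rfl

/-- Regeneration at a fixed `y` factorises the contribution of the gaps beyond `D(R, y)`;
integrating over `y` turns the scaling factor into the moment `M 0 (i + k + 1)`. -/
lemma IsMultiplicativelyRegenerative.meanGapMoment_eq_add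
    (hR : IsMultiplicativelyRegenerative μ R) (i k : ℕ) :
    meanGapMoment μ R i k = meanGapMoment μ R (i + 1) k + meanGapMoment μ R i (k + 1) +
      meanGapMoment μ R 0 (i + k + 1) * meanGapMoment μ R i k := by
  have hi1 := hR.integrable_gapMoment (μ := μ) (i + 1) k
  have hi2 := hR.integrable_gapMoment (μ := μ) i (k + 1)
  have hmeas : Measurable fun p : Ω × ℝ => gapMomentAfter i k (R p.1) p.2 := by
    have h : Measurable fun p : Ω × ℝ => (R p.1, p.2) :=
      (hR.measurable.comp measurable_fst).prodMk measurable_snd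
    have h2 : (fun p : Ω × ℝ => gapMomentAfter i k (R p.1) p.2) =
      (fun p : Closeds ℝ × ℝ => gapMomentAfter i k p.1 p.2) ∘ fun p : Ω × ℝ => (R p.1, p.2) := rfl
    rw [h2]
    exact (measurable_gapMomentAfter i k).comp h
  have hint : Integrable (Function.uncurry fun ω y => gapMomentAfter i k (R ω) y)
      (μ.prod unitVolume) :=
    Integrable.of_bound (C := 1) hmeas.aestronglyMeasurable
      (Filter.Eventually.of_forall fun p => norm_gapMomentAfter_le i k _ _)
  have hmeas2 : Measurable fun p : Ω × ℝ => gapWeight 0 (i + k + 1) (R p.1) p.2 :=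
    (hR.measurable.comp measurable_fst).gapWeight measurable_snd 0 (i + k + 1)
  have hint2 : Integrable (Function.uncurry fun ω y => gapWeight 0 (i + k + 1) (R ω) y)
      (μ.prod unitVolume) := by
    refine Integrable.of_bound (C := 1) hmeas2.aestronglyMeasurable ?_
    filter_upwards [Measure.quasiMeasurePreserving_snd.ae ae_unitVolume_mem] with p hp
    have := gapWeight_mem 0 (i + k + 1) (R p.1) hp
    rw [Real.norm_eq_abs, abs_le, Function.uncurry]
    exact ⟨by linarith [this.1], this.2⟩
  have key : ∫ ω, ∫ y, gapMomentAfter i k (R ω) y ∂unitVolume ∂μ =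
      meanGapMoment μ R 0 (i + k + 1) * meanGapMoment μ R i k := by
    rw [integral_integral_swap hint]
    have h1 : meanGapMoment μ R 0 (i + k + 1) =
        ∫ y, ∫ ω, gapWeight 0 (i + k + 1) (R ω) y ∂μ ∂unitVolume := integral_integral_swap hint2
    rw [h1, ← integral_mul_const]
    refine integral_congr_ae ?_
    filter_upwards [ae_unitVolume_mem, ae_restrict_of_ae (Measure.ae_ne volume (1 : ℝ))] with y hy hy1
    exact hR.integral_gapMomentAfter i k ⟨hy.1.le, lt_of_le_of_ne hy.2 hy1⟩
  conv_lhs => rw [meanGapMoment]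
  simp only [fun ω => gapMoment_eq_add_integral i k (R ω)]
  have hadd : ∫ ω, (gapMoment (i + 1) k (R ω) + gapMoment i (k + 1) (R ω) +
      ∫ y, gapMomentAfter i k (R ω) y ∂unitVolume) ∂μ =
      ∫ ω, (gapMoment (i + 1) k (R ω) + gapMoment i (k + 1) (R ω)) ∂μ +
        ∫ ω, ∫ y, gapMomentAfter i k (R ω) y ∂unitVolume ∂μ :=
    integral_add (hi1.add hi2) hint.integral_prod_left
  rw [hadd, integral_add hi1 hi2, key]
  rfl

lemma IsRandomClosedSubset.meanGapMoment_sum (hR : IsRandomClosedSubset R) (n : ℕ) :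
    (n + 1) * meanGapMoment μ R 0 n + ∑ j ∈ Finset.range n,
      (n + 1).choose (j + 2) * meanGapMoment μ R (j + 1) (n + 1 - (j + 2)) = 1 := by
  have h1 : ∫ ω, ((n + 1) * gapMoment 0 n (R ω) + ∑ j ∈ Finset.range n,
      (n + 1).choose (j + 2) * gapMoment (j + 1) (n + 1 - (j + 2)) (R ω)) ∂μ = 1 := by
    simp only [fun ω => gapMoment_sum (hR.isUnitClosed ω) n]
    simp
  rw [integral_add ((hR.integrable_gapMoment _ _).const_mul _)
    (integrable_finsetSum _ fun j _ => (hR.integrable_gapMoment _ _).const_mul _),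
    integral_finsetSum _ fun j _ => (hR.integrable_gapMoment _ _).const_mul _] at h1
  simpa only [integral_const_mul, meanGapMoment] using h1

/-- The probability that, of `n` uniform points, exactly the first `m` fall into the leftmost
gap that is hit (a point that falls into `R` counting as a gap). -/
noncomputable def gapFirstPartLaw (μ : Measure Ω) (R : Ω → Closeds ℝ) (n m : ℕ) : ℝ :=
  if m = 1 then n * meanGapMoment μ R 0 (n - 1)
  else n.choose m * meanGapMoment μ R (m - 1) (n - m)

omit [IsProbabilityMeasure μ] in
lemma meanGapMoment_nonneg (i k : ℕ) : 0 ≤ meanGapMoment μ R i k :=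
  integral_nonneg fun ω => (gapMoment_mem i k (R ω)).1

/-- The recursion is the one for moments with `i = m - 1` and `k = n - m`, multiplied by `(n + 1) (n
choose m)`. Only `m ≥ 2` is needed, which avoids the separate formula for singletons. -/
lemma IsMultiplicativelyRegenerative.isDecrementMatrix
    (hR : IsMultiplicativelyRegenerative μ R) : IsDecrementMatrix (gapFirstPartLaw μ R) where
  nonneg n m := by
    rw [gapFirstPartLaw]
    split_ifs
    · exact mul_nonneg (Nat.cast_nonneg _) (meanGapMoment_nonneg _ _)
    · exact mul_nonneg (Nat.cast_nonneg _) (meanGapMoment_nonneg _ _)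
  sum_eq_one n hn := by
    obtain ⟨n, rfl⟩ := Nat.exists_eq_add_of_le' hn
    rw [sum_Icc_one_succ, ← hR.meanGapMoment_sum (μ := μ) n]
    simp [gapFirstPartLaw]
  recursion n m hm hmn := by
    obtain ⟨i, rfl⟩ := Nat.exists_eq_add_of_le' hm
    obtain ⟨k, rfl⟩ := Nat.exists_eq_add_of_le' hmn
    have h := hR.meanGapMoment_eq_add (i + 1) k
    have c1 : (((i + 2 : ℕ) : ℝ) + 1) * ((k + (i + 2) + 1).choose (i + 2 + 1) : ℕ) =
        (((k + (i + 2) : ℕ) : ℝ) + 1) * (k + (i + 2)).choose (i + 2) := by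
      have := Nat.add_one_mul_choose_eq (k + (i + 2)) (i + 2)
      rw [mul_comm]
      exact_mod_cast this.symm
    have c2 : ((k + (i + 2) : ℕ) + 1 - (i + 2 : ℕ) : ℝ) * (k + (i + 2) + 1).choose (i + 2) =
        (((k + (i + 2) : ℕ) : ℝ) + 1) * (k + (i + 2)).choose (i + 2) := by
      have := Nat.choose_mul_succ_eq (k + (i + 2)) (i + 2)
      rw [show k + (i + 2) + 1 - (i + 2) = k + 1 by omega] at this
      have h3 : ((k + (i + 2) : ℕ) + 1 - (i + 2 : ℕ) : ℝ) = (k + 1 : ℕ) := by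
        push_cast; ring
      rw [h3, mul_comm, mul_comm (((k + (i + 2) : ℕ) : ℝ) + 1)]
      exact_mod_cast this.symm
    simp only [gapFirstPartLaw, if_true, show i + 2 ≠ 1 by omega, show i + 2 + 1 ≠ 1 by omega,
      if_false, show i + 2 - 1 = i + 1 by omega, show i + 2 + 1 - 1 = i + 2 by omega,
      show k + (i + 2) - (i + 2) = k by omega, show k + (i + 2) + 1 - (i + 2) = k + 1 by omega,
      show k + (i + 2) + 1 - (i + 2 + 1) = k by omega,
      show k + (i + 2) + 1 - 1 = i + 1 + k + 1 by omega]
    rw [← mul_assoc, ← mul_assoc, ← mul_assoc, c1, c2]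
    push_cast
    linear_combination ((k : ℝ) + (i + 2) + 1) * (k + (i + 2)).choose (i + 2) * h

/-! ### Comparison of the moments of two regenerative sets -/

variable {Ω₁ Ω₂ : Type*} [MeasurableSpace Ω₁] [MeasurableSpace Ω₂]
  {μ₁ : Measure Ω₁} {μ₂ : Measure Ω₂} [IsProbabilityMeasure μ₁] [IsProbabilityMeasure μ₂]
  {R₁ : Ω₁ → Closeds ℝ} {R₂ : Ω₂ → Closeds ℝ}

/-- All moments are determined by those with `k = 0`. -/
lemma IsMultiplicativelyRegenerative.meanGapMoment_eq
    (h₁ : IsMultiplicativelyRegenerative μ₁ R₁) (h₂ : IsMultiplicativelyRegenerative μ₂ R₂)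
    (h : ∀ n, meanGapMoment μ₁ R₁ (n + 1) 0 = meanGapMoment μ₂ R₂ (n + 1) 0) (i k : ℕ) :
    meanGapMoment μ₁ R₁ (i + 1) k = meanGapMoment μ₂ R₂ (i + 1) k := by
  have hq := h₁.isDecrementMatrix.eq_of_diag_eq h₂.isDecrementMatrix (fun n hn => by
    rcases hn.eq_or_lt with rfl | hn
    -- The entry with `n = 1` is always `1`; for `n ≥ 2` the diagonal entry is the moment with
    -- exponents `n - 1` and `0`.
    · have e1 := h₁.isDecrementMatrix.sum_eq_one 1 le_rfl
      have e2 := h₂.isDecrementMatrix.sum_eq_one 1 le_rfl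
      simp only [Finset.Icc_self, Finset.sum_singleton] at e1 e2
      rw [e1, e2]
    · obtain ⟨n, rfl⟩ := Nat.exists_eq_add_of_le' hn
      simp [gapFirstPartLaw, h]) (i + 2 + k) (i + 2) (by omega) (by omega)
  simp only [gapFirstPartLaw, show i + 2 ≠ 1 by omega, if_false, Nat.add_sub_cancel_left,
    show i + 2 - 1 = i + 1 by omega] at hq
  refine mul_left_cancel₀ ?_ hq
  exact_mod_cast (Nat.choose_pos (by omega)).ne'

/-- The law of the ranked lengths determines the moments with `k = 0`. -/
lemma meanGapMoment_zero_eq_of_identDistrib (h₁ : IsRandomClosedSubset R₁)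
    (h₂ : IsRandomClosedSubset R₂)
    (h : IdentDistrib (fun ω => rankedLengths (R₁ ω)) (fun ω => rankedLengths (R₂ ω)) μ₁ μ₂)
    (n : ℕ) : meanGapMoment μ₁ R₁ (n + 1) 0 = meanGapMoment μ₂ R₂ (n + 1) 0 := by
  have hu : Measurable fun y : ℕ → ℝ => ∑' j, ENNReal.ofReal (y j ^ (n + 2)) := by fun_prop
  have h3 := (h.comp hu).lintegral_eq
  simp only [Function.comp_def, ← gapMoment_zero_eq (h₁.isUnitClosed _),
    ← gapMoment_zero_eq (h₂.isUnitClosed _)] at h3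
  rw [meanGapMoment, meanGapMoment, integral_eq_lintegral_of_nonneg_ae, h3,
    ← integral_eq_lintegral_of_nonneg_ae]
  · exact Filter.Eventually.of_forall fun ω => (gapMoment_mem _ _ _).1
  · exact (h₂.integrable_gapMoment _ _).aestronglyMeasurable
  · exact Filter.Eventually.of_forall fun ω => (gapMoment_mem _ _ _).1
  · exact (h₁.integrable_gapMoment _ _).aestronglyMeasurable

end Regeneration

/-! ### The law of a gap is determined by its moments -/

/-- Finite measures on the unit square are determined by their moments. -/
lemma unitSquare_ext_of_moments {ρ₁ ρ₂ : Measure (unitInterval × unitInterval)}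
    [IsFiniteMeasure ρ₁] [IsFiniteMeasure ρ₂]
    (h : ∀ i k : ℕ, ∫ p, (p.1 : ℝ) ^ i * (p.2 : ℝ) ^ k ∂ρ₁ = ∫ p, (p.1 : ℝ) ^ i * (p.2 : ℝ) ^ k ∂ρ₂) :
    ρ₁ = ρ₂ := by
  let f : BoundedContinuousFunction (unitInterval × unitInterval) ℝ :=
    BoundedContinuousFunction.mkOfCompact ⟨fun p => (p.1 : ℝ), by fun_prop⟩
  let g : BoundedContinuousFunction (unitInterval × unitInterval) ℝ :=
    BoundedContinuousFunction.mkOfCompact ⟨fun p => (p.2 : ℝ), by fun_prop⟩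
  -- The polynomials in the two coordinates form an algebra that separates points, so their
  -- integrals determine the measure; by linearity the monomials suffice.
  let A : StarSubalgebra ℝ (BoundedContinuousFunction (unitInterval × unitInterval) ℝ) :=
    { Algebra.adjoin ℝ {f, g} with
      star_mem' := fun {a} ha => by
        have : star a = a := by ext p; simp
        rw [this]; exact ha }
  refine ext_of_forall_mem_subalgebra_integral_eq_of_polish (𝕜 := ℝ) (A := A) ?_ ?_
  · intro p q hpq
    have hfA : f ∈ A := Algebra.subset_adjoin (by simp)
    have hgA : g ∈ A := Algebra.subset_adjoin (by simp)
    by_cases h1 : p.1 = q.1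
    · have h2 : p.2 ≠ q.2 := fun h2 => hpq (Prod.ext h1 h2)
      refine ⟨g, ⟨_, ⟨g, hgA, rfl⟩, rfl⟩, fun h => h2 (Subtype.ext h)⟩
    · refine ⟨f, ⟨_, ⟨f, hfA, rfl⟩, rfl⟩, fun h => h1 (Subtype.ext h)⟩
  · intro a ha
    have ha' : a ∈ Submodule.span ℝ (Submonoid.closure {f, g} : Set _) := by
      rw [← Algebra.adjoin_eq_span]; exact ha
    clear ha
    induction ha' using Submodule.span_induction with
    | mem a ha =>
      obtain ⟨i, k, rfl⟩ := (Submonoid.mem_closure_pair f g a).1 ha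
      exact h i k
    | zero => simp
    | add a b _ _ h1 h2 =>
      simp only [BoundedContinuousFunction.add_apply]
      rw [integral_add (a.integrable _) (b.integrable _),
        integral_add (a.integrable _) (b.integrable _), h1, h2]
    | smul c a _ h1 =>
      simp only [BoundedContinuousFunction.smul_apply, integral_smul, h1]

/-- The coordinates `(b - a, 1 - b)` of the gap `]a, b[` that contains `x`. -/
noncomputable def gapCoord (F : Closeds ℝ) (x : ℝ) : unitInterval × unitInterval :=
  (Set.projIcc 0 1 zero_le_one (nextPoint F x - prevPoint F x),
    Set.projIcc 0 1 zero_le_one (1 - nextPoint F x))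

/-- The weight of a gap that covers `]z, w[`, as a function of `gapCoord`. -/
noncomputable def coverWeight (z w : ℝ) : unitInterval × unitInterval → ℝ≥0∞ :=
  {p : unitInterval × unitInterval | 1 - (p.2 : ℝ) - p.1 ≤ z ∧ w ≤ 1 - (p.2 : ℝ)}.indicator
    fun p => (ENNReal.ofReal p.1)⁻¹ ^ 2

lemma measurable_coverWeight (z w : ℝ) : Measurable (coverWeight z w) := by
  have h1 : Measurable fun p : unitInterval × unitInterval => (p.1 : ℝ) :=
    measurable_fst.subtype_coe
  have h2 : Measurable fun p : unitInterval × unitInterval => (p.2 : ℝ) :=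
    measurable_snd.subtype_coe
  refine Measurable.indicator (h1.ennreal_ofReal.inv.pow_const 2) ?_
  exact (measurableSet_le ((measurable_const.sub h2).sub h1) measurable_const).inter
    (measurableSet_le measurable_const (measurable_const.sub h2))

lemma gapCoord_val (F : Closeds ℝ) {x : ℝ} (hx : x ∈ Set.Ioc (0 : ℝ) 1) :
    ((gapCoord F x).1 : ℝ) = nextPoint F x - prevPoint F x ∧
      ((gapCoord F x).2 : ℝ) = 1 - nextPoint F x := by
  rw [gapCoord, Set.projIcc_of_mem _ (nextPoint_sub_prevPoint_mem F hx),
    Set.projIcc_of_mem _ (one_sub_nextPoint_mem F hx)]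
  exact ⟨rfl, rfl⟩

open Classical in
lemma coverWeight_gapCoord (z w : ℝ) (F : Closeds ℝ) {x : ℝ} (hx : x ∈ Set.Ioc (0 : ℝ) 1) :
    coverWeight z w (gapCoord F x) = if prevPoint F x ≤ z ∧ w ≤ nextPoint F x then
      (ENNReal.ofReal (nextPoint F x - prevPoint F x))⁻¹ ^ 2 else 0 := by
  obtain ⟨h1, h2⟩ := gapCoord_val F hx
  rw [coverWeight, Set.indicator_apply]
  simp only [Set.mem_ofPred_eq, h1, h2]
  rw [show 1 - (1 - nextPoint F x) - (nextPoint F x - prevPoint F x) = prevPoint F x by ring,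
    show 1 - (1 - nextPoint F x) = nextPoint F x by ring]

-- A gap is counted with its length once through the uniform point and once through `gapWeight 1 0`;
-- `coverWeight` divides by the square. The integral is therefore the number of gaps that cover `]z,
-- w[`, which is `0` or `1`.
open Classical in
lemma lintegral_coverWeight {F : Closeds ℝ} (hF : IsUnitClosed F) {z w : ℝ} (hz : 0 ≤ z)
    (hzw : z < w) (hw : w ≤ 1) :
    ∫⁻ x, ENNReal.ofReal (gapWeight 1 0 F x) * coverWeight z w (gapCoord F x) ∂unitVolume =
      if ((F : Set ℝ) ∩ Set.Ioo z w).Nonempty then 0 else 1 := by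
  have hgap : ∀ I : gaps F, ∫⁻ x in Set.Ioo I.1.1 I.1.2,
      ENNReal.ofReal (gapWeight 1 0 F x) * coverWeight z w (gapCoord F x) =
      if I.1.1 ≤ z ∧ w ≤ I.1.2 then 1 else 0 := by
    intro I
    have hlt : 0 < I.1.2 - I.1.1 := sub_pos.2 I.2.1
    obtain ⟨h0, h1⟩ := gap_subset_unit hF I.2
    calc _ = ∫⁻ x in Set.Ioo I.1.1 I.1.2, ENNReal.ofReal (I.1.2 - I.1.1) *
          (if I.1.1 ≤ z ∧ w ≤ I.1.2 then (ENNReal.ofReal (I.1.2 - I.1.1))⁻¹ ^ 2 else 0) := by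
          refine setLIntegral_congr_fun measurableSet_Ioo fun x hx => ?_
          have hx' : x ∈ Set.Ioc (0 : ℝ) 1 := ⟨h0.trans_lt hx.1, hx.2.le.trans h1⟩
          simp only [coverWeight_gapCoord z w F hx', gapWeight,
            nextPoint_eq_of_mem_gap hF I.2 hx, prevPoint_eq_of_mem_gap hF I.2 hx, pow_one, pow_zero,
            mul_one]
      _ = _ := by
          rw [lintegral_gap_const]
          split_ifs
          · have h2 : ENNReal.ofReal (I.1.2 - I.1.1) ≠ 0 := by simpa using hlt
            rw [mul_right_comm, ← sq, ← mul_pow, ENNReal.mul_inv_cancel h2 ENNReal.ofReal_ne_top,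
              one_pow]
          · simp
  have h0 : ∫⁻ x in Set.Ioc 0 1 ∩ (F : Set ℝ),
      ENNReal.ofReal (gapWeight 1 0 F x) * coverWeight z w (gapCoord F x) = 0 := by
    rw [← lintegral_zero (μ := volume.restrict (Set.Ioc 0 1 ∩ (F : Set ℝ)))]
    refine lintegral_congr_ae ?_
    filter_upwards [ae_restrict_mem (measurableSet_Ioc.inter F.isClosed.measurableSet),
      ae_restrict_of_ae (ae_mem_eq hF)] with x hx hx2
    obtain ⟨e1, e2⟩ := hx2 hx.2
    simp [gapWeight, e1, e2]
  rw [lintegral_unit_eq hF, h0, zero_add]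
  simp only [hgap]
  split_ifs with hne
  · obtain ⟨y, hy, hyz⟩ := hne
    refine ENNReal.tsum_eq_zero.2 fun I => if_neg fun h => ?_
    exact Set.disjoint_left.1 I.2.2.2.2 ⟨h.1.trans_lt hyz.1, hyz.2.trans_le h.2⟩ hy
  -- If `F` avoids `]z, w[`, the gap around the midpoint covers this interval, and any covering gap
  -- contains the midpoint.
  · set m := (z + w) / 2 with hm
    have hmem : m ∈ Set.Ioo z w := ⟨by linarith, by linarith⟩
    have hmF : m ∉ F := fun h => hne ⟨m, h, hmem⟩
    obtain ⟨hI, hmI⟩ := mem_gaps_of_notMem hF ⟨by linarith, by linarith⟩ hmF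
    have h1 : prevPoint F m ≤ z := by
      by_contra h
      exact hne ⟨_, prevPoint_mem hF.zero_mem m, not_le.1 h, hmI.1.trans hmem.2⟩
    have h2 : w ≤ nextPoint F m := by
      by_contra h
      exact hne ⟨_, nextPoint_mem hF.one_mem m, hmem.1.trans hmI.2, not_le.1 h⟩
    rw [tsum_eq_single ⟨_, hI⟩, if_pos ⟨h1, h2⟩]
    intro J hJ
    refine if_neg fun h => hJ (Subtype.ext ?_)
    have hmJ : m ∈ Set.Ioo J.1.1 J.1.2 := ⟨h.1.trans_lt hmem.1, hmem.2.trans_le h.2⟩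
    rw [Prod.ext_iff]
    exact ⟨(prevPoint_eq_of_mem_gap hF J.2 hmJ).symm, (nextPoint_eq_of_mem_gap hF J.2 hmJ).symm⟩

lemma Measurable.gapCoord {α : Type*} [MeasurableSpace α] {f : α → Closeds ℝ} {g : α → ℝ}
    (hf : Measurable f) (hg : Measurable g) : Measurable fun a => _root_.gapCoord (f a) (g a) :=
  (continuous_projIcc.measurable.comp ((hf.nextPoint hg).sub (hf.prevPoint hg))).prodMk
    (continuous_projIcc.measurable.comp (measurable_const.sub (hf.nextPoint hg)))

section GapLaw

variable {Ω : Type*} [MeasurableSpace Ω] {μ : Measure Ω} [IsProbabilityMeasure μ]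
  {R : Ω → Closeds ℝ}

/-- The law of `gapCoord`, biased by the length of the gap. -/
noncomputable def gapLaw (μ : Measure Ω) (R : Ω → Closeds ℝ) :
    Measure (unitInterval × unitInterval) :=
  ((μ.prod unitVolume).withDensity fun p => ENNReal.ofReal (gapWeight 1 0 (R p.1) p.2)).map
    fun p => gapCoord (R p.1) p.2

omit [IsProbabilityMeasure μ] in
lemma IsRandomClosedSubset.lintegral_gapLaw (hR : IsRandomClosedSubset R)
    {g : unitInterval × unitInterval → ℝ≥0∞} (hg : Measurable g) :
    ∫⁻ q, g q ∂(gapLaw μ R) = ∫⁻ ω, ∫⁻ x, ENNReal.ofReal (gapWeight 1 0 (R ω) x) *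
      g (gapCoord (R ω) x) ∂unitVolume ∂μ := by
  have h1 : Measurable fun p : Ω × ℝ => gapCoord (R p.1) p.2 :=
    (hR.measurable.comp measurable_fst).gapCoord measurable_snd
  have h2 : Measurable fun p : Ω × ℝ => ENNReal.ofReal (gapWeight 1 0 (R p.1) p.2) :=
    ((hR.measurable.comp measurable_fst).gapWeight measurable_snd 1 0).ennreal_ofReal
  have h3 : Measurable fun p : Ω × ℝ => g (gapCoord (R p.1) p.2) := hg.comp h1
  rw [gapLaw, lintegral_map hg h1, lintegral_withDensity_eq_lintegral_mul _ h2 h3]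
  exact lintegral_prod _ (h2.mul h3).aemeasurable

lemma IsRandomClosedSubset.isFiniteMeasure_gapLaw (hR : IsRandomClosedSubset R) :
    IsFiniteMeasure (gapLaw μ R) := by
  refine ⟨?_⟩
  rw [← setLIntegral_one, Measure.restrict_univ, hR.lintegral_gapLaw measurable_const]
  refine lt_of_le_of_lt (b := ∫⁻ ω, ∫⁻ x, 1 ∂unitVolume ∂μ) (lintegral_mono fun ω => ?_) (by simp)
  refine lintegral_mono_ae ?_
  filter_upwards [ae_unitVolume_mem] with x hx
  rw [mul_one]
  exact ENNReal.ofReal_le_one.2 (gapWeight_mem 1 0 (R ω) hx).2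

/-- The density is one more factor of the gap length, so exactly the moments with first exponent at
least `1` appear: those fixed by the ranked lengths. -/
lemma IsRandomClosedSubset.integral_gapLaw (hR : IsRandomClosedSubset R) (i k : ℕ) :
    ∫ q, (q.1 : ℝ) ^ i * (q.2 : ℝ) ^ k ∂(gapLaw μ R) = meanGapMoment μ R (i + 1) k := by
  rw [integral_eq_lintegral_of_nonneg_ae, hR.lintegral_gapLaw (by fun_prop), meanGapMoment,
    integral_eq_lintegral_of_nonneg_ae]
  · congr 1
    refine lintegral_congr fun ω => ?_
    rw [gapMoment, ofReal_integral_eq_lintegral_ofReal (integrable_gapWeight _ _ _)]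
    · refine lintegral_congr_ae ?_
      filter_upwards [ae_unitVolume_mem] with x hx
      obtain ⟨h1, h2⟩ := gapCoord_val (R ω) hx
      rw [h1, h2, ← ENNReal.ofReal_mul (gapWeight_mem 1 0 (R ω) hx).1]
      congr 1
      simp only [gapWeight]
      ring
    · filter_upwards [ae_unitVolume_mem] with x hx using (gapWeight_mem _ _ _ hx).1
  · exact Filter.Eventually.of_forall fun ω => (gapMoment_mem _ _ _).1
  · exact (hR.integrable_gapMoment _ _).aestronglyMeasurable
  · refine Filter.Eventually.of_forall fun q => ?_
    have h1 := q.1.2.1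
    have h2 := q.2.2.1
    simp only [Pi.zero_apply]
    positivity
  · exact Measurable.aestronglyMeasurable (by fun_prop)

omit [IsProbabilityMeasure μ] in
/-- The probability that `R` does not hit an interval. -/
lemma IsRandomClosedSubset.measure_not_hits (hR : IsRandomClosedSubset R) {z w : ℝ} (hz : 0 ≤ z)
    (hzw : z < w) (hw : w ≤ 1) :
    μ {ω | ¬ ((R ω : Set ℝ) ∩ Set.Ioo z w).Nonempty} = ∫⁻ q, coverWeight z w q ∂(gapLaw μ R) := by
  classical
  have hm : MeasurableSet {ω | ¬ ((R ω : Set ℝ) ∩ Set.Ioo z w).Nonempty} :=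
    hR.measurable (measurableSet_hits _ isOpen_Ioo).compl
  rw [hR.lintegral_gapLaw (measurable_coverWeight z w), ← lintegral_indicator_one hm]
  refine lintegral_congr fun ω => ?_
  rw [lintegral_coverWeight (hR.isUnitClosed ω) hz hzw hw, Set.indicator_apply]
  simp only [Set.mem_ofPred_eq, Pi.one_apply, ite_not]

end GapLaw

/-! ### The law of a multiplicatively regenerative set -/

/-- `F` has no point in any of the given intervals. -/
def Avoids (s : Finset (ℝ × ℝ)) (F : Closeds ℝ) : Prop :=
  ∀ I ∈ s, ¬ ((F : Set ℝ) ∩ Set.Ioo I.1 I.2).Nonempty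

lemma measurableSet_avoids (s : Finset (ℝ × ℝ)) : MeasurableSet {F | Avoids s F} := by
  have : {F | Avoids s F} = ⋂ I ∈ s, {F : Closeds ℝ | ((F : Set ℝ) ∩ Set.Ioo I.1 I.2).Nonempty}ᶜ := by
    ext F
    simp [Avoids]
  rw [this]
  exact Finset.measurableSet_biInter s fun I _ => (measurableSet_hits _ isOpen_Ioo).compl

lemma isPiSystem_avoids : IsPiSystem {S | ∃ s, S = {F : Closeds ℝ | Avoids s F}} := by
  classical
  rintro _ ⟨s, rfl⟩ _ ⟨t, rfl⟩ -
  refine ⟨s ∪ t, ?_⟩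
  ext F
  simp only [Avoids, Set.mem_inter_iff, Set.mem_ofPred_eq, Finset.mem_union, or_imp, forall_and]

/-- An open set is a countable union of rational intervals, so hitting it is a countable union of
complements of avoidance events. -/
lemma generateFrom_avoids : closedsRealMeasurableSpace =
    MeasurableSpace.generateFrom {S | ∃ s, S = {F : Closeds ℝ | Avoids s F}} := by
  refine le_antisymm (MeasurableSpace.generateFrom_le ?_) (MeasurableSpace.generateFrom_le ?_)
  · rintro _ ⟨G, hG, rfl⟩
    have : {F : Closeds ℝ | ((F : Set ℝ) ∩ G).Nonempty} =
        ⋃ p : {p : ℚ × ℚ // Set.Ioo (p.1 : ℝ) p.2 ⊆ G},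
          {F : Closeds ℝ | Avoids {((p.1.1 : ℝ), (p.1.2 : ℝ))} F}ᶜ := by
      ext F
      simp only [Set.mem_ofPred_eq, Set.mem_iUnion, Set.mem_compl_iff, Avoids,
        Finset.mem_singleton, forall_eq, not_not]
      constructor
      · rintro ⟨y, hy, hyG⟩
        obtain ⟨l, u, hlu, hsub⟩ := mem_nhds_iff_exists_Ioo_subset.1 (hG.mem_nhds hyG)
        obtain ⟨a, ha1, ha2⟩ := exists_rat_btwn hlu.1
        obtain ⟨b, hb1, hb2⟩ := exists_rat_btwn hlu.2
        exact ⟨⟨(a, b), (Set.Ioo_subset_Ioo ha1.le hb2.le).trans hsub⟩, y, hy, ha2, hb1⟩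
      · rintro ⟨p, y, hy, hyp⟩
        exact ⟨y, hy, p.2 hyp⟩
    rw [this]
    refine @MeasurableSet.iUnion _ _ (_) _ _ fun p => ?_
    refine @MeasurableSet.compl _ _ (_) ?_
    exact MeasurableSpace.measurableSet_generateFrom ⟨_, rfl⟩
  · rintro _ ⟨s, rfl⟩
    exact measurableSet_avoids s

/-- Points of `F` to the right of `p ≥ z` are automatically at or beyond `D(F, z)`, so nothing is
lost even when the rescaled left end point is negative. -/
lemma rescaledPartAfter_hits_Ioo_iff {F : Closeds ℝ} (hF : IsUnitClosed F) {z : ℝ} (hz : z < 1)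
    (hd : firstPointAfter F z < 1) {p q : ℝ} (hp : z ≤ p) :
    ((rescaledPartAfter F z : Set ℝ) ∩
      Set.Ioo ((p - firstPointAfter F z) / (1 - firstPointAfter F z))
        ((q - firstPointAfter F z) / (1 - firstPointAfter F z))).Nonempty ↔
      ((F : Set ℝ) ∩ Set.Ioo p q).Nonempty := by
  set d := firstPointAfter F z with hdd
  have hr : 0 < 1 - d := by linarith
  have hset : (rescaledPartAfter F z : Set ℝ) =
    (fun y : ℝ => (y - d) / (1 - d)) '' ((F : Set ℝ) ∩ Set.Icc d 1) := rfl
  rw [hset]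
  constructor
  · rintro ⟨_, ⟨y, ⟨hy, -⟩, rfl⟩, h1, h2⟩
    rw [div_lt_div_iff_of_pos_right hr] at h1 h2
    exact ⟨y, hy, by linarith, by linarith⟩
  · rintro ⟨y, hy, h1, h2⟩
    refine ⟨_, ⟨y, ⟨hy, ?_, (hF.subset_unit hy).2⟩, rfl⟩, ?_, ?_⟩
    · rw [hdd, firstPointAfter_eq_nextPoint hF.one_mem hz]
      exact nextPoint_le_of_mem hy (hp.trans_lt h1)
    · rw [div_lt_div_iff_of_pos_right hr]; linarith
    · rw [div_lt_div_iff_of_pos_right hr]; linarith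

lemma le_firstPointAfter_iff {F : Closeds ℝ} (hF : IsUnitClosed F) {z w : ℝ} (hz : z < 1)
    (hw : w ≤ 1) : w ≤ firstPointAfter F z ↔ ¬ ((F : Set ℝ) ∩ Set.Ioo z w).Nonempty := by
  rw [firstPointAfter_eq_nextPoint hF.one_mem hz, ← not_lt, nextPoint_lt_iff, min_eq_left hw]
  simp [hw.not_gt]

section Law

variable {Ω Ω₁ Ω₂ : Type*} [MeasurableSpace Ω] [MeasurableSpace Ω₁] [MeasurableSpace Ω₂]
  {μ : Measure Ω} {μ₁ : Measure Ω₁} {μ₂ : Measure Ω₂} [IsProbabilityMeasure μ]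
  [IsProbabilityMeasure μ₁] [IsProbabilityMeasure μ₂]
  {R : Ω → Closeds ℝ} {R₁ : Ω₁ → Closeds ℝ} {R₂ : Ω₂ → Closeds ℝ}

lemma firstPointAfter_le_one {F : Closeds ℝ} (hF : IsUnitClosed F) {z : ℝ} (hz : z < 1) :
    firstPointAfter F z ≤ 1 := by
  rw [firstPointAfter_eq_nextPoint hF.one_mem hz]
  exact nextPoint_le_one F z

lemma le_firstPointAfter {F : Closeds ℝ} (hF : IsUnitClosed F) {z : ℝ} (hz : z < 1) :
    z ≤ firstPointAfter F z := by
  rw [firstPointAfter_eq_nextPoint hF.one_mem hz]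
  exact le_nextPoint F hz.le

/-- The avoidance probabilities of single intervals determine the laws of `D(R, z)`. -/
lemma map_firstPointAfter_eq (h₁ : IsRandomClosedSubset R₁) (h₂ : IsRandomClosedSubset R₂)
    (h : ∀ z w : ℝ, 0 ≤ z → z < w → w ≤ 1 →
      μ₁ {ω | ¬ ((R₁ ω : Set ℝ) ∩ Set.Ioo z w).Nonempty} =
        μ₂ {ω | ¬ ((R₂ ω : Set ℝ) ∩ Set.Ioo z w).Nonempty})
    {z : ℝ} (hz : z ∈ Set.Ico (0 : ℝ) 1) :
    μ₁.map (fun ω => firstPointAfter (R₁ ω) z) = μ₂.map (fun ω => firstPointAfter (R₂ ω) z) := by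
  have m₁ := h₁.measurable_firstPointAfter hz.2
  have m₂ := h₂.measurable_firstPointAfter hz.2
  refine Measure.ext_of_Ici _ _ fun w => ?_
  rw [Measure.map_apply m₁ measurableSet_Ici, Measure.map_apply m₂ measurableSet_Ici]
  rcases lt_or_ge 1 w with hw | hw
  · have e₁ : (fun ω => firstPointAfter (R₁ ω) z) ⁻¹' Set.Ici w = ∅ := by
      ext ω
      simpa using (firstPointAfter_le_one (h₁.isUnitClosed ω) hz.2).trans_lt hw
    have e₂ : (fun ω => firstPointAfter (R₂ ω) z) ⁻¹' Set.Ici w = ∅ := by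
      ext ω
      simpa using (firstPointAfter_le_one (h₂.isUnitClosed ω) hz.2).trans_lt hw
    rw [e₁, e₂, measure_empty, measure_empty]
  · rcases le_or_gt w z with hwz | hwz
    · have e₁ : (fun ω => firstPointAfter (R₁ ω) z) ⁻¹' Set.Ici w = Set.univ := by
        ext ω
        simpa using hwz.trans (le_firstPointAfter (h₁.isUnitClosed ω) hz.2)
      have e₂ : (fun ω => firstPointAfter (R₂ ω) z) ⁻¹' Set.Ici w = Set.univ := by
        ext ω
        simpa using hwz.trans (le_firstPointAfter (h₂.isUnitClosed ω) hz.2)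
      rw [e₁, e₂, measure_univ, measure_univ]
    · simp only [Set.preimage, Set.mem_Ici, le_firstPointAfter_iff (h₁.isUnitClosed _) hz.2 hw,
        le_firstPointAfter_iff (h₂.isUnitClosed _) hz.2 hw]
      exact h z w hz.1 hwz hw

open Classical in
/-- The intervals of `s`, seen from the point `d`. -/
noncomputable def rescaleIntervals (s : Finset (ℝ × ℝ)) (d : ℝ) : Finset (ℝ × ℝ) :=
  s.image fun J => ((J.1 - d) / (1 - d), (J.2 - d) / (1 - d))

lemma avoids_rescaleIntervals_iff (s : Finset (ℝ × ℝ)) (d : ℝ) (F : Closeds ℝ) :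
    Avoids (rescaleIntervals s d) F ↔ ∀ J ∈ s, ¬ ((F : Set ℝ) ∩
      Set.Ioo ((J.1 - d) / (1 - d)) ((J.2 - d) / (1 - d))).Nonempty := by
  simp only [Avoids, rescaleIntervals, Finset.forall_mem_image]

lemma measurableSet_avoids_rescaleIntervals (s : Finset (ℝ × ℝ)) :
    MeasurableSet {p : ℝ × Closeds ℝ | Avoids (rescaleIntervals s p.1) p.2} := by
  have : {p : ℝ × Closeds ℝ | Avoids (rescaleIntervals s p.1) p.2} = ⋂ J ∈ s,
      (fun p : ℝ × Closeds ℝ => ((J.1 - p.1) / (1 - p.1), (J.2 - p.1) / (1 - p.1), p.2)) ⁻¹'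
        {p : ℝ × ℝ × Closeds ℝ | ((p.2.2 : Set ℝ) ∩ Set.Ioo p.1 p.2.1).Nonempty}ᶜ := by
    ext p
    simp [avoids_rescaleIntervals_iff]
  rw [this]
  refine Finset.measurableSet_biInter s fun J _ => ?_
  have h : Measurable fun p : ℝ × Closeds ℝ =>
    ((J.1 - p.1) / (1 - p.1), (J.2 - p.1) / (1 - p.1), p.2) := by fun_prop
  exact h measurableSet_hits_Ioo.compl

/-- The avoidance probability on the event that `D(R, z) < 1`, where `z` is the least left
end point. -/
lemma IsMultiplicativelyRegenerative.measure_avoids_inter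
    (hR : IsMultiplicativelyRegenerative μ R) {s : Finset (ℝ × ℝ)} {I : ℝ × ℝ} (hI : I ∈ s)
    (hz : 0 ≤ I.1) (hzw : I.1 < I.2) (hw : I.2 ≤ 1) (hmin : ∀ J ∈ s, I.1 ≤ J.1) [DecidableEq (ℝ × ℝ)] :
    μ ({ω | Avoids s (R ω)} ∩ {ω | firstPointAfter (R ω) I.1 < 1}) =
      ∫⁻ d in Set.Iio 1 ∩ Set.Ici I.2, μ {ω | Avoids (rescaleIntervals (s.erase I) d) (R ω)}
        ∂(μ.map fun ω => firstPointAfter (R ω) I.1) := by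
  have hz1 : I.1 < 1 := hzw.trans_le hw
  have hD := hR.measurable_firstPointAfter hz1
  obtain ⟨hm, hmap⟩ := hR.map_restrict ⟨hz, hz1⟩
  set A := {ω | firstPointAfter (R ω) I.1 < 1} with hA
  have hmA : MeasurableSet A := measurableSet_lt hD measurable_const
  -- Avoiding `I` means that `D(R, I.1)` is at least `I.2`; given this, avoiding the other intervals
  -- concerns only the rescaled set.
  set B := {p : ℝ × Closeds ℝ | I.2 ≤ p.1} ∩
    {p : ℝ × Closeds ℝ | Avoids (rescaleIntervals (s.erase I) p.1) p.2} with hB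
  have hmB : MeasurableSet B := (measurableSet_le measurable_const measurable_fst).inter
    (measurableSet_avoids_rescaleIntervals _)
  have h1 : μ ({ω | Avoids s (R ω)} ∩ A) = (μ.restrict A).map
      (fun ω => (firstPointAfter (R ω) I.1, rescaledPartAfter (R ω) I.1)) B := by
    rw [Measure.map_apply_of_aemeasurable (hD.aemeasurable.prodMk hm) hmB,
      Measure.restrict_apply' hmA]
    congr 1
    ext ω
    simp only [Set.mem_inter_iff, Set.mem_ofPred_eq, Set.mem_preimage, hB, hA]
    refine and_congr_left fun hd => ?_
    have hF := hR.isUnitClosed ω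
    rw [le_firstPointAfter_iff hF hz1 hw, avoids_rescaleIntervals_iff]
    constructor
    · intro h
      refine ⟨h I hI, fun J hJ => ?_⟩
      have hJs := Finset.mem_of_mem_erase hJ
      rw [rescaledPartAfter_hits_Ioo_iff hF hz1 hd (hmin J hJs)]
      exact h J hJs
    · rintro ⟨h2, h3⟩ J hJ
      by_cases hJI : J = I
      · rwa [hJI]
      · rw [← rescaledPartAfter_hits_Ioo_iff hF hz1 hd (hmin J hJ)]
        exact h3 J (Finset.mem_erase.2 ⟨hJI, hJ⟩)
  have hrm : (μ.restrict A).map (fun ω => firstPointAfter (R ω) I.1) =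
      (μ.map fun ω => firstPointAfter (R ω) I.1).restrict (Set.Iio 1) := by
    rw [Measure.restrict_map hD measurableSet_Iio]
    rfl
  have hpr : IsProbabilityMeasure (μ.map R) :=
    Measure.isProbabilityMeasure_map hR.measurable.aemeasurable
  rw [h1, hmap, Measure.prod_apply hmB, hrm, ← lintegral_indicator measurableSet_Iio,
    ← lintegral_indicator (measurableSet_Iio.inter measurableSet_Ici)]
  refine lintegral_congr fun d => ?_
  simp only [Set.indicator_apply, Set.mem_inter_iff, Set.mem_Iio, Set.mem_Ici]
  by_cases hd1 : d < 1
  · by_cases hd2 : I.2 ≤ d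
    · rw [if_pos hd1, if_pos ⟨hd1, hd2⟩]
      have : Prod.mk d ⁻¹' B = {F | Avoids (rescaleIntervals (s.erase I) d) F} := by
        ext F
        simp [hB, hd2]
      rw [this, Measure.map_apply hR.measurable (measurableSet_avoids _)]
      rfl
    · have : Prod.mk d ⁻¹' B = ∅ := by
        ext F
        simp [hB, hd2]
      rw [if_pos hd1, if_neg (fun h => hd2 h.2), this, measure_empty]
  · rw [if_neg hd1, if_neg (fun h => hd1 h.1)]

-- When `D(R, z) = 1` the only point of `R` beyond `z` is `1`, so the avoidance of `s` is no longer
-- random.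
omit [IsProbabilityMeasure μ] in
open Classical in
lemma IsRandomClosedSubset.measure_avoids_inter_compl (hR : IsRandomClosedSubset R)
    {s : Finset (ℝ × ℝ)} {z : ℝ} (hz : z < 1) (hmin : ∀ J ∈ s, z ≤ J.1) :
    μ ({ω | Avoids s (R ω)} \ {ω | firstPointAfter (R ω) z < 1}) =
      if ∀ J ∈ s, (1 : ℝ) ∉ Set.Ioo J.1 J.2 then
        (μ.map fun ω => firstPointAfter (R ω) z) (Set.Iio 1)ᶜ else 0 := by
  have hD := hR.measurable_firstPointAfter hz
  have key : ∀ ω, ¬ firstPointAfter (R ω) z < 1 →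
      (Avoids s (R ω) ↔ ∀ J ∈ s, (1 : ℝ) ∉ Set.Ioo J.1 J.2) := by
    intro ω hω
    refine forall₂_congr fun J hJ => not_congr ⟨?_, fun h => ⟨1, hR.one_mem ω, h⟩⟩
    rintro ⟨y, hy, hyJ⟩
    have h1 : y = 1 := by
      refine le_antisymm (hR.subset_unit ω hy).2 ((not_lt.1 hω).trans ?_)
      rw [firstPointAfter_eq_nextPoint (hR.one_mem ω) hz]
      exact nextPoint_le_of_mem hy ((hmin J hJ).trans_lt hyJ.1)
    rwa [← h1]
  rw [Measure.map_apply hD measurableSet_Iio.compl]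
  split_ifs with h
  · congr 1
    ext ω
    simp only [Set.mem_sdiff, Set.mem_ofPred_eq, Set.mem_preimage, Set.mem_compl_iff, Set.mem_Iio]
    exact ⟨fun h1 => h1.2, fun h1 => ⟨(key ω h1).2 h, h1⟩⟩
  · have : {ω | Avoids s (R ω)} \ {ω | firstPointAfter (R ω) z < 1} = ∅ := by
      ext ω
      simp only [Set.mem_sdiff, Set.mem_ofPred_eq, Set.mem_empty_iff_false, iff_false, not_and]
      exact fun h1 h2 => h ((key ω h2).1 h1)
    rw [this, measure_empty]

/-- The avoidance probabilities of single intervals determine those of all finite unions of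
intervals. -/
lemma IsMultiplicativelyRegenerative.measure_avoids_eq
    (h₁ : IsMultiplicativelyRegenerative μ₁ R₁) (h₂ : IsMultiplicativelyRegenerative μ₂ R₂)
    (h : ∀ z w : ℝ, 0 ≤ z → z < w → w ≤ 1 →
      μ₁ {ω | ¬ ((R₁ ω : Set ℝ) ∩ Set.Ioo z w).Nonempty} =
        μ₂ {ω | ¬ ((R₂ ω : Set ℝ) ∩ Set.Ioo z w).Nonempty}) (n : ℕ) :
    ∀ s : Finset (ℝ × ℝ), s.card ≤ n →
      μ₁ {ω | Avoids s (R₁ ω)} = μ₂ {ω | Avoids s (R₂ ω)} := by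
  classical
  induction n with
  | zero =>
    intro s hs
    obtain rfl : s = ∅ := by simpa using hs
    simp [Avoids]
  | succ n ih =>
    intro s hs
    rcases s.eq_empty_or_nonempty with rfl | hne
    · simp [Avoids]
    -- Regeneration takes place at the least left end point. Intervals that miss `[0,1]` or contain
    -- `0` or `1` are disposed of separately, so that `0 ≤ I.1 < I.2 ≤ 1`.
    obtain ⟨I, hI, hmin⟩ := s.exists_min_image Prod.fst hne
    have hcard : (s.erase I).card ≤ n := by rw [Finset.card_erase_of_mem hI]; omega
    have irrelevant : ∀ F : Closeds ℝ, ¬ ((F : Set ℝ) ∩ Set.Ioo I.1 I.2).Nonempty →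
        (Avoids s F ↔ Avoids (s.erase I) F) := by
      intro F hF
      refine ⟨fun h J hJ => h J (Finset.mem_of_mem_erase hJ), fun h J hJ => ?_⟩
      by_cases hJI : J = I
      · rwa [hJI]
      · exact h J (Finset.mem_erase.2 ⟨hJI, hJ⟩)
    by_cases hempty : Disjoint (Set.Icc (0 : ℝ) 1) (Set.Ioo I.1 I.2)
    · have e : ∀ F : Closeds ℝ, IsUnitClosed F → (Avoids s F ↔ Avoids (s.erase I) F) := by
        intro F hF
        refine irrelevant F ?_
        rintro ⟨y, hy, hyI⟩
        exact Set.disjoint_left.1 hempty (hF.subset_unit hy) hyI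
      simp only [e _ (h₁.isUnitClosed _), e _ (h₂.isUnitClosed _)]
      exact ih _ hcard
    by_cases hend : (0 : ℝ) ∈ Set.Ioo I.1 I.2 ∨ (1 : ℝ) ∈ Set.Ioo I.1 I.2
    · have e : ∀ F : Closeds ℝ, IsUnitClosed F → ¬ Avoids s F := by
        intro F hF hav
        refine hav I hI ?_
        rcases hend with h0 | h0
        · exact ⟨0, hF.zero_mem, h0⟩
        · exact ⟨1, hF.one_mem, h0⟩
      simp [e _ (h₁.isUnitClosed _), e _ (h₂.isUnitClosed _)]
    obtain ⟨y, hy, hyI⟩ := Set.not_disjoint_iff.1 hempty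
    simp only [Set.mem_Ioo, not_or, not_and, not_lt] at hend
    have hz : 0 ≤ I.1 := by
      by_contra hlt
      exact (hyI.2.trans_le (hend.1 (not_le.1 hlt))).not_ge hy.1
    have hw : I.2 ≤ 1 := hend.2 (hyI.1.trans_le hy.2)
    have hzw : I.1 < I.2 := hyI.1.trans hyI.2
    have hz1 : I.1 < 1 := hzw.trans_le hw
    rw [← measure_inter_add_sdiff _ (measurableSet_lt (h₁.measurable_firstPointAfter hz1)
        measurable_const),
      ← measure_inter_add_sdiff _ (measurableSet_lt (h₂.measurable_firstPointAfter hz1)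
        measurable_const),
      h₁.measure_avoids_inter hI hz hzw hw hmin, h₂.measure_avoids_inter hI hz hzw hw hmin,
      h₁.measure_avoids_inter_compl hz1 hmin, h₂.measure_avoids_inter_compl hz1 hmin,
      map_firstPointAfter_eq h₁.toIsRandomClosedSubset h₂.toIsRandomClosedSubset h ⟨hz, hz1⟩]
    congr 1
    -- For each value `d` of `D(R, I.1)` the rescaled family has at most `n` intervals, so the
    -- induction hypothesis applies pointwise under the common law of `D(R, I.1)`.
    exact lintegral_congr fun d => ih _ (Finset.card_image_le.trans hcard)

/-- The law of a multiplicatively regenerative set is determined by the law of its ranked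
lengths. -/
theorem IsMultiplicativelyRegenerative.identDistrib
    (h₁ : IsMultiplicativelyRegenerative μ₁ R₁) (h₂ : IsMultiplicativelyRegenerative μ₂ R₂)
    (h : IdentDistrib (fun ω => rankedLengths (R₁ ω)) (fun ω => rankedLengths (R₂ ω)) μ₁ μ₂) :
    IdentDistrib R₁ R₂ μ₁ μ₂ := by
  have hmom := h₁.meanGapMoment_eq h₂
    (meanGapMoment_zero_eq_of_identDistrib h₁.toIsRandomClosedSubset h₂.toIsRandomClosedSubset h)
  have := h₁.isFiniteMeasure_gapLaw (μ := μ₁)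
  have := h₂.isFiniteMeasure_gapLaw (μ := μ₂)
  have hlaw : gapLaw μ₁ R₁ = gapLaw μ₂ R₂ := unitSquare_ext_of_moments fun i k => by
    rw [h₁.integral_gapLaw, h₂.integral_gapLaw, hmom]
  have hav := h₁.measure_avoids_eq h₂ fun z w hz hzw hw => by
    rw [h₁.measure_not_hits hz hzw hw, h₂.measure_not_hits hz hzw hw, hlaw]
  refine ⟨h₁.measurable.aemeasurable, h₂.measurable.aemeasurable, ?_⟩
  have := Measure.isProbabilityMeasure_map (μ := μ₁) h₁.measurable.aemeasurable
  have := Measure.isProbabilityMeasure_map (μ := μ₂) h₂.measurable.aemeasurable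
  refine ext_of_generate_finite _ generateFrom_avoids isPiSystem_avoids ?_ (by simp)
  rintro _ ⟨s, rfl⟩
  rw [Measure.map_apply h₁.measurable (measurableSet_avoids s),
    Measure.map_apply h₂.measurable (measurableSet_avoids s)]
  exact hav _ s le_rfl

end Law

/-! ### The three uniqueness statements -/

theorem mainTheorem5 :
    -- the law of an exchangeable partition of `ℕ` corresponds to at most one law of a
    -- regenerative composition structure
    (∀ {Ω₀ Ω₁ Ω₂ : Type*} [MeasurableSpace Ω₀] [MeasurableSpace Ω₁] [MeasurableSpace Ω₂]
      (μ₀ : Measure Ω₀) (μ₁ : Measure Ω₁) (μ₂ : Measure Ω₂)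
      [IsProbabilityMeasure μ₀] [IsProbabilityMeasure μ₁] [IsProbabilityMeasure μ₂]
      (P : Ω₀ → Setoid ℕ) (C₁ : (n : ℕ) → Ω₁ → Composition n) (C₂ : (n : ℕ) → Ω₂ → Composition n),
      IsExchangeablePartition μ₀ P →
      IsRegenerativeCompositionStructure μ₁ C₁ → IsRegenerativeCompositionStructure μ₂ C₂ →
      PartitionCorrespondsTo μ₀ P μ₁ C₁ → PartitionCorrespondsTo μ₀ P μ₂ C₂ →
      IdentDistrib (fun ω n => C₁ n ω) (fun ω n => C₂ n ω) μ₁ μ₂) ∧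
    -- a partition structure is induced by at most one law of a regenerative composition structure
    (∀ {Ω₁ Ω₂ : Type*} [MeasurableSpace Ω₁] [MeasurableSpace Ω₂]
      (μ₁ : Measure Ω₁) (μ₂ : Measure Ω₂) [IsProbabilityMeasure μ₁] [IsProbabilityMeasure μ₂]
      (p : (n : ℕ) → PMF n.Partition)
      (C₁ : (n : ℕ) → Ω₁ → Composition n) (C₂ : (n : ℕ) → Ω₂ → Composition n),
      IsPartitionStructure p →
      IsRegenerativeCompositionStructure μ₁ C₁ → IsRegenerativeCompositionStructure μ₂ C₂ →
      InducesPartitionStructure μ₁ C₁ p → InducesPartitionStructure μ₂ C₂ p →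
      IdentDistrib (fun ω n => C₁ n ω) (fun ω n => C₂ n ω) μ₁ μ₂) ∧
    -- a law of ranked lengths is realized by at most one law of a multiplicatively regenerative set
    (∀ {Ω₀ Ω₁ Ω₂ : Type*} [MeasurableSpace Ω₀] [MeasurableSpace Ω₁] [MeasurableSpace Ω₂]
      (μ₀ : Measure Ω₀) (μ₁ : Measure Ω₁) (μ₂ : Measure Ω₂)
      [IsProbabilityMeasure μ₀] [IsProbabilityMeasure μ₁] [IsProbabilityMeasure μ₂]
      (Y : Ω₀ → ℕ → ℝ) (R₁ : Ω₁ → Closeds ℝ) (R₂ : Ω₂ → Closeds ℝ),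
      Measurable Y → (∀ ω, Antitone (Y ω)) → (∀ ω j, 0 ≤ Y ω j) →
      (∀ ω, Summable (Y ω) ∧ ∑' j, Y ω j ≤ 1) →
      IsMultiplicativelyRegenerative μ₁ R₁ → IsMultiplicativelyRegenerative μ₂ R₂ →
      IdentDistrib (fun ω => rankedLengths (R₁ ω)) Y μ₁ μ₀ →
      IdentDistrib (fun ω => rankedLengths (R₂ ω)) Y μ₂ μ₀ →
      IdentDistrib R₁ R₂ μ₁ μ₂) := by 
  refine ⟨?_, ?_, ?_⟩
  · intro Ω₀ Ω₁ Ω₂ _ _ _ μ₀ μ₁ μ₂ _ _ _ P C₁ C₂ _ h₁ h₂ hc₁ hc₂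
    refine h₁.identDistrib h₂ fun n hn => ?_
    rw [hc₁.measure_single n hn, hc₂.measure_single n hn]
  · intro Ω₁ Ω₂ _ _ μ₁ μ₂ _ _ p C₁ C₂ _ h₁ h₂ hc₁ hc₂
    refine h₁.identDistrib h₂ fun n hn => ?_
    rw [hc₁.measure_single n hn, hc₂.measure_single n hn]
  · intro Ω₀ Ω₁ Ω₂ _ _ _ μ₀ μ₁ μ₂ _ _ _ Y R₁ R₂ _ _ _ _ h₁ h₂ hd₁ hd₂
    exact h₁.identDistrib h₂ (hd₁.trans hd₂.symm)
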